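/- \textbf{Setting.} All manifolds are finite-dimensional, smooth and without boundary. Let $Q$ be a smooth manifold and $L_d:Q\times Q\to\mathbb R$ a smooth function (a discrete mechanical system $(Q,L_d)$). Let $G$ be a Lie group acting smoothly, freely and properly on the left on $Q$, such that $L_d(g q_0,g q_1)=L_d(q_0,q_1)$ for all $g\in G$, $q_0,q_1\in Q$. Let $\pi:Q\to Q/G$ be the quotient principal bundle, let $\mathfrak g$ be the Lie algebra of $G$, and for $\xi\in\mathfrak g$ let $\xi_Q(q)=\frac{d}{dt}\big|_{t=0}\exp(t\xi)q$. Let $\rho:Q\times G\to\tilde G:=(Q\times G)/G$ be the quotient map for the action $g\cdot(q,w)=(gq,gwg^{-1})$. Let $\gamma:Q\to G$ be smooth with $\gamma(gq)=g\gamma(q)g^{-1}$, and let $\mathcal A_d$ be an affine discrete connection of level $\gamma$ defined on the whole space: it is given by a $G$-invariant (for the diagonal action) embedded submanifold $\mathrm{Hor}\subseteq Q\times Q$ containing $\{(q,\gamma(q)q):q\in Q\}$ such that $(\mathrm{id}_Q\times\pi)|_{\mathrm{Hor}}:\mathrm{Hor}\to Q\times Q/G$ is a bijective local diffeomorphism.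 Its connection form $\mathcal A_d:Q\times Q\to G$ sends $(q_0,q_1)$ to the unique $g\in G$ with $(q_0,g^{-1}q_1)\in\mathrm{Hor}$. The map $\tilde\Phi(q_0,q_1)=(q_0,\mathcal A_d(q_0,q_1),\pi(q_1))$ is a bijection $Q\times Q\to Q\times G\times Q/G$; put $\check L_d:=L_d\circ\tilde\Phi^{-1}$ and define $\hat L_d:\tilde G\times Q/G\to\mathbb R$ by $\hat L_d(\rho(q,w),\tau)=\check L_d(q,w,\tau)$. Let $\mathfrak A:TQ\to\mathfrak g$ be (the connection form of) a principal connection on $\pi$ and $h^q:T_{\pi(q)}(Q/G)\to T_qQ$ its horizontal lift. Here $D_if$ is the restriction of the differential of $f$ to the tangent space of the $i$-th factor. For a discrete curve $q_\cdot=(q_0,\dots,q_N)$ in $Q$ put $S_d(q_\cdot)=\sum_{k=0}^{N-1}L_d(q_k,q_{k+1})$, and for curves $v_\cdot=(v_0,\dots,v_{N-1})$ in $\tilde G$ and $\tau_\cdot=(\tau_1,\dots,\tau_N)$ in $Q/G$ put $\hat S_d(v_\cdot,\tau_\cdot)=\sum_{k=0}^{N-1}\hat L_d(v_k,\tau_{k+1})$.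 \textbf{Theorem.} Let $q_\cdot=(q_0,\dots,q_N)$ be a discrete curve in $Q$, and let $\tau_k=\pi(q_k)$, $w_k=\mathcal A_d(q_k,q_{k+1})$, $v_k=\rho(q_k,w_k)$. The following are equivalent. (1) $dS_d(q_\cdot)(\delta q_\cdot)=0$ for all $\delta q_\cdot=(\delta q_0,\dots,\delta q_N)$ with $\delta q_k\in T_{q_k}Q$ and $\delta q_0=0$, $\delta q_N=0$. (2) $D_2L_d(q_{k-1},q_k)+D_1L_d(q_k,q_{k+1})=0\in T^*_{q_k}Q$ for all $k=1,\dots,N-1$. (3) $d\hat S_d(v_\cdot,\tau_\cdot)(\delta v_\cdot,\delta\tau_\cdot)=0$ for all $\delta\tau_k\in T_{\tau_k}(Q/G)$ and $\xi_k\in\mathfrak g$ ($k=0,\dots,N$) with $\delta\tau_0=0$, $\delta\tau_N=0$, $\xi_0=\xi_N=0$, where for $k=0,\dots,N-1$ $$\begin{aligned}\delta v_k={}&T_{(q_k,w_k)}\rho\big(h^{q_k}(\delta\tau_k),\,T_{(q_k,q_{k+1})}\mathcal A_d(h^{q_k}(\delta\tau_k),h^{q_{k+1}}(\delta\tau_{k+1}))\big)\\&+T_{(q_k,w_k)}\rho\big((\xi_k)_Q(q_k),\,T_{(q_k,q_{k+1})}\mathcal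 A_d((\xi_k)_Q(q_k),(\xi_{k+1})_Q(q_{k+1}))\big).\end{aligned}$$ (4) For all $k=1,\dots,N-1$: $\phi=0$ and $\psi=0$, where $\phi\in T^*_{\tau_k}(Q/G)$ and $\psi\in\mathfrak g^*$ are $$\begin{aligned}\phi={}&D_1\check L_d(q_k,w_k,\tau_{k+1})\circ h^{q_k}+D_3\check L_d(q_{k-1},w_{k-1},\tau_k)\\&+D_2\check L_d(q_k,w_k,\tau_{k+1})\circ D_1\mathcal A_d(q_k,q_{k+1})\circ h^{q_k}\\&+D_2\check L_d(q_{k-1},w_{k-1},\tau_k)\circ D_2\mathcal A_d(q_{k-1},q_k)\circ h^{q_k},\end{aligned}$$ $$\psi=D_2\check L_d(q_{k-1},w_{k-1},\tau_k)\,w_{k-1}^{-1}-D_2\check L_d(q_k,w_k,\tau_{k+1})\,w_k^{-1},$$ and $\alpha w^{-1}\in\mathfrak g^*$ denotes, for $\alpha\in T_w^*G$, the functional $\xi\mapsto\alpha(T_eR_w\,\xi)$, with $R_w$ the right translation by $w$. -/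

import Mathlib

open scoped Manifold ContDiff Topology
open Set Filter
set_option linter.unusedSectionVars false

noncomputable section

namespace DMSReduction

section Orbit
variable {E : Type*} [NormedAddCommGroup E] [NormedSpace ℝ E] [FiniteDimensional ℝ E]
  {H : Type*} [TopologicalSpace H] (I : ModelWithCorners ℝ E H)
  {F : Type*} [NormedAddCommGroup F] [NormedSpace ℝ F] [FiniteDimensional ℝ F]
  {H' : Type*} [TopologicalSpace H'] (J : ModelWithCorners ℝ F H')
  {G : Type*} [TopologicalSpace G] [ChartedSpace H' G] [Group G]
  {Q : Type*} [TopologicalSpace Q] [ChartedSpace H Q] [MulAction G Q]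

theorem eventually_const_of_mfderiv_zero [I.Boundaryless] [IsManifold I ∞ Q]
    {c : ℝ → Q} 
    (hc : ∀ᶠ t in 𝓝 (0 : ℝ), HasMFDerivAt 𝓘(ℝ, ℝ) I c t 0) : ∀ᶠ t in 𝓝 (0 : ℝ), c t = c 0 := by
  have hc0 : ContinuousAt c 0 := hc.self_of_nhds.continuousAt
  have h1 : ∀ᶠ t in 𝓝 (0 : ℝ), c t ∈ (chartAt H (c 0)).source :=
    hc0.eventually ((chartAt H (c 0)).open_source.mem_nhds (mem_chart_source H (c 0)))
  obtain ⟨ε, hε, hball⟩ := Metric.eventually_nhds_iff_ball.1 (hc.and h1)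
  have hd : ∀ t ∈ Metric.ball (0 : ℝ) ε, HasDerivAt (fun t => extChartAt I (c 0) (c t)) 0 t := by
    intro t ht
    obtain ⟨h2, h3⟩ := hball t ht
    have h4 := (mdifferentiableAt_extChartAt (I := I) h3).hasMFDerivAt.comp t h2
    rw [ContinuousLinearMap.comp_zero] at h4
    have h5 : HasFDerivAt (extChartAt I (c 0) ∘ c) (0 : ℝ →L[ℝ] E) t := h4.hasFDerivAt
    exact h5.hasDerivAt
  filter_upwards [Metric.ball_mem_nhds 0 hε] with t ht
  have hconst := (convex_ball (0 : ℝ) ε).is_const_of_fderivWithin_eq_zero (𝕜 := ℝ)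
    (f := fun t => extChartAt I (c 0) (c t))
    (fun s hs => (hd s hs).differentiableAt.differentiableWithinAt) (fun s hs => by
      rw [fderivWithin_of_isOpen Metric.isOpen_ball hs]
      exact (hasDerivAt_iff_hasFDerivAt.1 (hd s hs)).fderiv.trans (by ext; simp)) ht (Metric.mem_ball_self hε)
  refine (extChartAt I (c 0)).injOn ?_ (mem_extChartAt_source _) hconst
  rw [extChartAt_source]; exact (hball t ht).2

theorem orbit_mfderiv_injective [I.Boundaryless] [J.Boundaryless] [IsManifold I ∞ Q]
    [LieGroup J ∞ G] [ContMDiffSMul J I ∞ G Q] [IsCancelSMul G Q] (q : Q) :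
    Function.Injective (mfderiv J I (fun g : G => g • q) 1) := by
  have : LieGroup J (minSmoothness ℝ 3) G := LieGroup.of_le (n := ∞)
    (by simpa using WithTop.coe_le_coe.2 (le_top : (3 : ℕ∞) ≤ ⊤))
  have hact : ContMDiff (J.prod I) I ∞ (fun p : G × Q => p.1 • p.2) := contMDiff_smul
  have horb : ContMDiff J I ∞ (fun g : G => g • q) :=
    hact.comp (contMDiff_id.prodMk contMDiff_const)
  have htr : ∀ g : G, ContMDiff I I ∞ (fun x : Q => g • x) := fun g =>
    hact.comp (contMDiff_const.prodMk contMDiff_id)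
  have hmul : ∀ g : G, ContMDiff J J ∞ (fun x : G => g * x) := fun g => contMDiff_mul_left
  rw [injective_iff_map_eq_zero]
  intro ξ hξ
  obtain ⟨c, hc0, hc⟩ := exists_isMIntegralCurveAt_of_contMDiffAt_boundaryless (I := J) (M := G)
    (v := mulInvariantVectorField ξ) (x₀ := (1 : G)) (0 : ℝ)
    ((contMDiff_mulInvariantVectorField ξ).contMDiffAt.of_le (by simp))
  have hne : (∞ : ℕ∞ω) ≠ 0 := by simp
  have hdz : ∀ᶠ t in 𝓝 (0 : ℝ), HasMFDerivAt 𝓘(ℝ, ℝ) I (fun t => c t • q) t 0 := by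
    filter_upwards [hc] with t ht
    have h1 := ((horb.mdifferentiable hne) (c t)).hasMFDerivAt.comp t ht
    have h2 : mfderiv J I (fun g : G => g • q) (c t) (mulInvariantVectorField ξ (c t)) = 0 := by
      have e1 : (fun x : Q => c t • x) ∘ (fun g : G => g • q)
          = (fun g : G => g • q) ∘ (fun x : G => c t * x) := by
        ext g; simp [mul_smul]
      have e2 := mfderiv_comp (I := J) (I' := I) (I'' := I) (1 : G)
        ((htr (c t)).mdifferentiable hne _) (horb.mdifferentiable hne (1 : G))
      have e3 := mfderiv_comp (I := J) (I' := J) (I'' := I) (1 : G)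
        (horb.mdifferentiable hne _) ((hmul (c t)).mdifferentiable hne (1 : G))
      rw [e1, e3] at e2
      have e4 := congrArg (fun f => f ξ) e2
      have e5 : mfderiv I I (fun x : Q => c t • x) ((1 : G) • q)
        (mfderiv J I (fun g : G => g • q) 1 ξ) = 0 := by rw [hξ]; exact map_zero _
      have e6 := e4.trans e5
      have e7 : mfderiv J I (fun g : G => g • q) (c t * 1) (mfderiv J J (fun x => c t * x) 1 ξ) = 0 := e6
      have e8 : ∀ g : G, g = c t → mfderiv J I (fun g : G => g • q) g
          (mfderiv J J (fun x => c t * x) 1 ξ : F) = (0 : E) →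
          mfderiv J I (fun g : G => g • q) (c t) (mfderiv J J (fun x => c t * x) 1 ξ : F) = (0 : E) := by
        rintro g rfl h; exact h
      exact e8 _ (mul_one _) e7
    convert! h1 using 1
    refine ContinuousLinearMap.ext_ring ?_
    have e9 : ((1 : ℝ →L[ℝ] ℝ).smulRight (mulInvariantVectorField ξ (c t) : F)) 1
      = mulInvariantVectorField ξ (c t) := by simp
    exact (h2.symm.trans (congrArg _ e9.symm))
  have hev := eventually_const_of_mfderiv_zero I hdz
  have hev2 : c =ᶠ[𝓝 0] fun _ => (1 : G) := by
    filter_upwards [hev] with t ht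
    rw [hc0] at ht
    exact IsCancelSMul.right_cancel _ _ _ ht
  have h3 := hc.self_of_nhds
  have h4 := (hasMFDerivAt_const (I := 𝓘(ℝ, ℝ)) (I' := J) (1 : G) (0 : ℝ)).congr_of_eventuallyEq hev2
  have h5 := hasMFDerivAt_unique h3 h4
  have h6 := congrArg (fun f => f (1 : ℝ)) h5
  have h7 : ((1 : ℝ →L[ℝ] ℝ).smulRight (mulInvariantVectorField ξ (c 0) : F)) 1 = (0 : F) := h6
  rw [ContinuousLinearMap.smulRight_apply, one_apply_eq_self, one_smul, hc0] at h7
  have h8 : mulInvariantVectorField ξ (1 : G) = ξ := by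
    have h9 : ∀ f : G → G, f = id → (mfderiv J J f 1 ξ : F) = (ξ : F) := by
      rintro _ rfl
      exact congrArg (fun f => f ξ) (mfderiv_id (I := J) (x := (1 : G)))
    exact h9 _ (funext one_mul)
  exact h8.symm.trans h7


/-- Model space of the quotient of a manifold modelled on `E` by a Lie group modelled on `F`. -/
abbrev QuotModel (E F : Type*) [NormedAddCommGroup E] [NormedSpace ℝ E]
    [NormedAddCommGroup F] [NormedSpace ℝ F] : Type :=
  EuclideanSpace ℝ (Fin (Module.finrank ℝ E - Module.finrank ℝ F))

theorem exists_complement_equiv (A : F →L[ℝ] E) (hA : Function.Injective A) :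
    ∃ L : (F × QuotModel E F) ≃L[ℝ] E, ∀ a, L (a, 0) = A a := by
  obtain ⟨W, hW⟩ := Submodule.exists_isCompl (LinearMap.range (A : F →ₗ[ℝ] E))
  have e1 : F ≃ₗ[ℝ] LinearMap.range (A : F →ₗ[ℝ] E) := LinearEquiv.ofInjective _ hA
  have hfin : Module.finrank ℝ (QuotModel E F) = Module.finrank ℝ W := by
    have h1 := Submodule.finrank_add_eq_of_isCompl hW
    have h2 := LinearMap.finrank_range_of_inj (f := (A : F →ₗ[ℝ] E)) hA
    rw [finrank_euclideanSpace_fin]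
    omega
  let e2 : QuotModel E F ≃ₗ[ℝ] W := LinearEquiv.ofFinrankEq _ _ hfin
  let L : (F × QuotModel E F) ≃ₗ[ℝ] E :=
    ((LinearEquiv.ofInjective (A : F →ₗ[ℝ] E) hA).prodCongr e2).trans
      (Submodule.prodEquivOfIsCompl _ _ hW)
  refine ⟨L.toContinuousLinearEquiv, fun a => ?_⟩
  simp [L]

/-- Smooth local slice data for the orbits of a group action. -/
structure LocalSlice (G : Type*) [TopologicalSpace G] [ChartedSpace H' G] [Group G]
    [MulAction G Q] (q : Q) where
  dom : Set Q
  isOpen_dom : IsOpen dom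
  mem_dom : q ∈ dom
  proj : Q → QuotModel E F
  sec : QuotModel E F → Q
  transl : Q → G
  proj_smooth : ContMDiffOn I 𝓘(ℝ, QuotModel E F) ∞ proj dom
  transl_smooth : ContMDiffOn I J ∞ transl dom
  isOpen_image : IsOpen (proj '' dom)
  sec_smooth : ContMDiffOn 𝓘(ℝ, QuotModel E F) I ∞ sec (proj '' dom)
  transl_smul_sec : ∀ x ∈ dom, transl x • sec (proj x) = x
  proj_smul : ∀ (g : G), ∀ x ∈ dom, g • x ∈ dom → proj (g • x) = proj x

theorem nonempty_localSlice [I.Boundaryless] [J.Boundaryless] [IsManifold I ∞ Q]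
    [LieGroup J ∞ G] [ContMDiffSMul J I ∞ G Q] [ProperSMul G Q] [IsCancelSMul G Q] (q : Q) :
    Nonempty (LocalSlice I J G q) := by
  have hact : ContMDiff (J.prod I) I ∞ (fun p : G × Q => p.1 • p.2) := contMDiff_smul
  have horb : ContMDiff J I ∞ (fun g : G => g • q) :=
    hact.comp (contMDiff_id.prodMk contMDiff_const)
  have hne : (∞ : ℕ∞ω) ≠ 0 := by simp
  have : IsTopologicalGroup G := topologicalGroup_of_lieGroup J ∞
  let A : F →L[ℝ] E := mfderiv J I (fun g : G => g • q) 1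
  have hA : Function.Injective A := orbit_mfderiv_injective I J q
  obtain ⟨L, hL⟩ := exists_complement_equiv A hA
  let φ := extChartAt I q
  let ψ := extChartAt J (1 : G)
  let σ : QuotModel E F → Q := fun s => φ.symm (φ q + L (0, s))
  let Θ : F × QuotModel E F → Q := fun z => ψ.symm z.1 • σ z.2
  let O1 : Set (F × QuotModel E F) := {z | z.1 ∈ ψ.target ∧ φ q + L (0, z.2) ∈ φ.target}
  have hO1 : IsOpen O1 :=
    ((isOpen_extChartAt_target (1 : G)).preimage continuous_fst).inter
      ((isOpen_extChartAt_target q).preimage (by fun_prop))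
  have haff : ContDiff ℝ ∞ (fun s : QuotModel E F => φ q + L (0, s)) := by fun_prop
  have hσ : ContMDiffOn 𝓘(ℝ, QuotModel E F) I ∞ σ {s | φ q + L (0, s) ∈ φ.target} :=
    (contMDiffOn_extChartAt_symm q).comp haff.contMDiff.contMDiffOn (fun s hs => hs)
  have hΘ : ContMDiffOn 𝓘(ℝ, F × QuotModel E F) I ∞ Θ O1 := by
    have h1 : ContMDiffOn 𝓘(ℝ, F × QuotModel E F) J ∞ (fun z => ψ.symm z.1) O1 :=
      (contMDiffOn_extChartAt_symm (1 : G)).comp contDiff_fst.contMDiff.contMDiffOn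
        (fun z hz => hz.1)
    have h2 : ContMDiffOn 𝓘(ℝ, F × QuotModel E F) I ∞ (fun z => σ z.2) O1 :=
      hσ.comp contDiff_snd.contMDiff.contMDiffOn (fun z hz => hz.2)
    exact hact.comp_contMDiffOn (h1.prodMk h2)
  let O2 : Set (F × QuotModel E F) := O1 ∩ Θ ⁻¹' φ.source
  have hO2 : IsOpen O2 := hΘ.continuousOn.isOpen_inter_preimage hO1 (isOpen_extChartAt_source q)
  let Ψ : F × QuotModel E F → E := fun z => φ (Θ z)
  have hΨ : ContDiffOn ℝ ∞ Ψ O2 :=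
    ((contMDiffOn_extChartAt (I := I) (x := q)).comp (hΘ.mono inter_subset_left)
      (fun z hz => by rw [← extChartAt_source I]; exact hz.2)).contDiffOn
  let z0 : F × QuotModel E F := (ψ 1, 0)
  have hψ1 : ψ.symm (ψ 1) = 1 := extChartAt_to_inv (I := J) (1 : G)
  have hσ0 : σ 0 = q := by
    simp only [σ]
    rw [show ((0 : F), (0 : QuotModel E F)) = 0 from rfl, map_zero, add_zero]
    exact extChartAt_to_inv q
  have hΘ0 : Θ z0 = q := by simp [Θ, z0, hψ1, hσ0]
  have hz0 : z0 ∈ O2 := by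
    refine ⟨⟨mem_extChartAt_target _, ?_⟩, ?_⟩
    · simp only [z0]
      rw [show ((0 : F), (0 : QuotModel E F)) = 0 from rfl, map_zero, add_zero]
      exact mem_extChartAt_target _
    · change Θ z0 ∈ φ.source
      rw [hΘ0]; exact mem_extChartAt_source _
  have hΨat : ContDiffAt ℝ ∞ Ψ z0 := hΨ.contDiffAt (hO2.mem_nhds hz0)
  have hderiv : HasFDerivAt Ψ (L : (F × QuotModel E F) →L[ℝ] E) z0 := by
    have hD := (hΨat.differentiableAt hne).hasFDerivAt
    suffices h : fderiv ℝ Ψ z0 = (L : (F × QuotModel E F) →L[ℝ] E) by rwa [h] at hD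
    have i1 : HasFDerivAt (fun a : F => (a, (0 : QuotModel E F)))
        (ContinuousLinearMap.inl ℝ F (QuotModel E F)) (ψ 1) :=
      (hasFDerivAt_id _).prodMk (hasFDerivAt_const _ _)
    have i2 : HasFDerivAt (fun s : QuotModel E F => (ψ 1, s))
        (ContinuousLinearMap.inr ℝ F (QuotModel E F)) 0 :=
      (hasFDerivAt_const _ _).prodMk (hasFDerivAt_id _)
    have d1 := HasFDerivAt.comp (ψ 1) (g := Ψ) hD i1
    have d2 := HasFDerivAt.comp (0 : QuotModel E F) (g := Ψ) hD i2
    have e1 : HasFDerivAt (Ψ ∘ fun a : F => (a, (0 : QuotModel E F))) A (ψ 1) := by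
      have h1 : HasFDerivWithinAt (writtenInExtChartAt J I (1 : G) (fun g : G => g • q)) A
        (range J) (ψ 1) := ((horb.mdifferentiable hne) 1).hasMFDerivAt.2
      rw [J.range_eq_univ, hasFDerivWithinAt_univ] at h1
      have h2 : writtenInExtChartAt J I (1 : G) (fun g : G => g • q)
          = Ψ ∘ fun a : F => (a, (0 : QuotModel E F)) := by
        ext a
        simp only [writtenInExtChartAt, Function.comp, one_smul, Ψ, Θ, hσ0, φ, ψ]
      rwa [h2] at h1
    have e2 : HasFDerivAt (Ψ ∘ fun s : QuotModel E F => (ψ 1, s))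
        ((L : (F × QuotModel E F) →L[ℝ] E).comp (ContinuousLinearMap.inr ℝ F (QuotModel E F))) 0 := by
      have h1 : HasFDerivAt (fun s : QuotModel E F => φ q + L (0, s))
        ((L : (F × QuotModel E F) →L[ℝ] E).comp (ContinuousLinearMap.inr ℝ F (QuotModel E F))) 0 :=
        (((L : (F × QuotModel E F) →L[ℝ] E).comp
          (ContinuousLinearMap.inr ℝ F (QuotModel E F))).hasFDerivAt).const_add _
      refine h1.congr_of_eventuallyEq ?_
      have h2 : ∀ᶠ s in 𝓝 (0 : QuotModel E F), (ψ 1, s) ∈ O2 :=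
        i2.continuousAt.eventually (hO2.mem_nhds hz0)
      filter_upwards [h2] with s hs
      simp only [Function.comp, Ψ, Θ, σ, hψ1, one_smul]
      exact φ.right_inv hs.1.2
    have u1 := d1.unique e1
    have u2 := d2.unique e2
    ext1
    · exact u1.trans (ContinuousLinearMap.ext fun a => (hL a).symm)
    · exact u2
  -- the local inverse, restricted to where all derivatives are invertible
  let R0 := hΨat.toOpenPartialHomeomorph Ψ hderiv (by simp)
  have hR0 : ∀ z, R0 z = Ψ z := fun z => rfl
  let O3 : Set (F × QuotModel E F) :=
    O2 ∩ (fderiv ℝ Ψ) ⁻¹' (range ((↑) : ((F × QuotModel E F) ≃L[ℝ] E) → _))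
  have hO3 : IsOpen O3 :=
    (hΨ.continuousOn_fderiv_of_isOpen hO2 (by simp)).isOpen_inter_preimage hO2
      ContinuousLinearEquiv.isOpen
  have hz3 : z0 ∈ O3 := ⟨hz0, by rw [mem_preimage, hderiv.fderiv]; exact ⟨L, rfl⟩⟩
  let R := R0.restrOpen O3 hO3
  have hzR : z0 ∈ R.source :=
    ⟨hΨat.mem_toOpenPartialHomeomorph_source hderiv (by simp), hz3⟩
  have hRsub : ∀ z ∈ R.source, z ∈ O3 := fun z hz => hz.2
  have hRapp : ∀ z, R z = Ψ z := fun z => rfl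
  have hRsymm : ContDiffOn ℝ ∞ R.symm R.target := by
    intro y hy
    have hz := hRsub _ (R.map_target hy)
    obtain ⟨D, hD⟩ := hz.2
    refine (R.contDiffAt_symm hy (f₀' := D) ?_ (hΨ.contDiffAt (hO2.mem_nhds hz.1))).contDiffWithinAt
    rw [hD]
    exact ((hΨ.contDiffAt (hO2.mem_nhds hz.1)).differentiableAt hne).hasFDerivAt
  let U0 : Set Q := φ.source ∩ φ ⁻¹' R.target
  have hU0 : IsOpen U0 :=
    (continuousOn_extChartAt q).isOpen_inter_preimage (isOpen_extChartAt_source q) R.open_target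
  let p : Q → QuotModel E F := fun x => (R.symm (φ x)).2
  let θ : Q → G := fun x => ψ.symm (R.symm (φ x)).1
  have hφq : φ q = R z0 := by rw [hRapp]; simp only [Ψ, hΘ0]
  have hRq : R.symm (φ q) = z0 := by rw [hφq]; exact R.left_inv hzR
  have hpq : p q = 0 := by simp only [p, hRq, z0]
  have hθq : θ q = 1 := by simp only [θ, hRq, z0, hψ1]
  have hqU0 : q ∈ U0 :=
    ⟨mem_extChartAt_source _, by rw [mem_preimage, hφq]; exact R.map_source hzR⟩
  have hRφ : ContMDiffOn I 𝓘(ℝ, F × QuotModel E F) ∞ (fun x => R.symm (φ x)) U0 :=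
    hRsymm.contMDiffOn.comp ((contMDiffOn_extChartAt (I := I) (x := q)).mono
      (fun x hx => by rw [← extChartAt_source I]; exact hx.1)) (fun x hx => hx.2)
  have hp : ContMDiffOn I 𝓘(ℝ, QuotModel E F) ∞ p U0 :=
    contDiff_snd.contMDiff.comp_contMDiffOn hRφ
  have hRsrc : ∀ x ∈ U0, R.symm (φ x) ∈ R.source := fun x hx => R.map_target hx.2
  have hθ : ContMDiffOn I J ∞ θ U0 := by
    have h1 : ContMDiffOn I 𝓘(ℝ, F) ∞ (fun x => (R.symm (φ x)).1) U0 :=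
      contDiff_fst.contMDiff.comp_contMDiffOn hRφ
    exact (contMDiffOn_extChartAt_symm (1 : G)).comp h1
      (fun x hx => (hRsub _ (hRsrc x hx)).1.1.1)
  have hθσ : ∀ x ∈ U0, θ x • σ (p x) = x := by
    intro x hx
    have h1 : φ (Θ (R.symm (φ x))) = φ x := R.right_inv hx.2
    exact φ.injOn (hRsub _ (hRsrc x hx)).1.2 hx.1 h1
  have hpopen : ∀ V ⊆ U0, IsOpen V → IsOpen (p '' V) := by
    intro V hVU hV
    have h1 : p '' V = Prod.snd '' (R.source ∩ R ⁻¹' (φ.target ∩ φ.symm ⁻¹' V)) := by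
      ext s
      constructor
      · rintro ⟨x, hx, rfl⟩
        refine ⟨R.symm (φ x), ⟨hRsrc x (hVU hx), ?_⟩, rfl⟩
        rw [mem_preimage, R.right_inv (hVU hx).2]
        refine ⟨φ.map_source (hVU hx).1, ?_⟩
        rw [mem_preimage, φ.left_inv (hVU hx).1]; exact hx
      · rintro ⟨z, ⟨hz, hz1, hz2⟩, rfl⟩
        refine ⟨φ.symm (R z), hz2, ?_⟩
        simp only [p]
        rw [φ.right_inv hz1, R.left_inv hz]
    rw [h1]
    refine isOpenMap_snd _ (R.isOpen_inter_preimage ?_)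
    exact (continuousOn_extChartAt_symm q).isOpen_inter_preimage (isOpen_extChartAt_target q) hV
  -- points of a small neighbourhood in the same orbit have the same projection
  have hθc : ContinuousAt θ q := (hθ.continuousOn).continuousAt (hU0.mem_nhds hqU0)
  have hpc : ContinuousAt p q := (hp.continuousOn).continuousAt (hU0.mem_nhds hqU0)
  have hactc : ContinuousAt (fun z : G × Q => z.1 • z.2) (1, q) := hact.continuous.continuousAt
  let k : G × Q → G := fun z => (θ (z.1 • z.2))⁻¹ * z.1 * θ z.2
  have hθc1 : ContinuousAt (fun z : G × Q => θ (z.1 • z.2)) (1, q) :=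
    ContinuousAt.comp_of_eq (g := θ) (f := fun z : G × Q => z.1 • z.2) hθc hactc (one_smul G q)
  have hpc1 : ContinuousAt (fun z : G × Q => p (z.1 • z.2)) (1, q) :=
    ContinuousAt.comp_of_eq (g := p) (f := fun z : G × Q => z.1 • z.2) hpc hactc (one_smul G q)
  have hθc2 : ContinuousAt (fun z : G × Q => θ z.2) (1, q) :=
    ContinuousAt.comp_of_eq (g := θ) (f := fun z : G × Q => z.2) hθc continuousAt_snd rfl
  have hpc2 : ContinuousAt (fun z : G × Q => p z.2) (1, q) :=
    ContinuousAt.comp_of_eq (g := p) (f := fun z : G × Q => z.2) hpc continuousAt_snd rfl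
  have hkc : ContinuousAt k (1, q) := (hθc1.inv.mul continuousAt_fst).mul hθc2
  have hk1 : k (1, q) = 1 := by simp [k, hθq]
  have hψc : ContinuousAt ψ 1 := continuousAt_extChartAt (1 : G)
  have hψk : ContinuousAt (fun z => ψ (k z)) (1, q) := ContinuousAt.comp_of_eq hψc hkc hk1
  have hW : ∀ᶠ z in 𝓝 ((1 : G), q), k z ∈ ψ.source ∧ (ψ (k z), p z.2) ∈ R.source ∧
      (ψ 1, p (z.1 • z.2)) ∈ R.source := by
    refine (hkc.eventually ?_).and (((hψk.prodMk hpc2).eventually ?_).and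
      ((continuousAt_const.prodMk hpc1).eventually ?_))
    · rw [hk1]; exact (isOpen_extChartAt_source _).mem_nhds (mem_extChartAt_source _)
    · simp only [hk1, hpq]; exact R.open_source.mem_nhds hzR
    · simp only [one_smul, hpq]; exact R.open_source.mem_nhds hzR
  have hprop := (ProperSMul.isProperMap_smul_pair (G := G) (X := Q)).isClosedMap.eventually_nhds_fiber
    (p := fun z : G × Q => k z ∈ ψ.source ∧ (ψ (k z), p z.2) ∈ R.source ∧
      (ψ 1, p (z.1 • z.2)) ∈ R.source) (q, q) (by
      rintro ⟨g, x⟩ hgx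
      simp only [mem_preimage, mem_singleton_iff, Prod.mk.injEq] at hgx
      obtain ⟨h1, rfl⟩ := hgx
      have h2 : g = 1 := IsCancelSMul.right_cancel _ _ x (by rw [h1, one_smul])
      subst h2
      exact hW)
  obtain ⟨V1, V2, hV1, hqV1, hV2, hqV2, hV⟩ := mem_nhds_prod_iff'.1 hprop
  have hVopen : IsOpen (U0 ∩ (V1 ∩ V2)) := hU0.inter (hV1.inter hV2)
  refine ⟨{ dom := U0 ∩ (V1 ∩ V2), isOpen_dom := hVopen, mem_dom := ⟨hqU0, hqV1, hqV2⟩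
            proj := p, sec := σ, transl := θ
            proj_smooth := hp.mono inter_subset_left
            transl_smooth := hθ.mono inter_subset_left
            isOpen_image := hpopen _ inter_subset_left hVopen
            sec_smooth := hσ.mono ?_
            transl_smul_sec := fun x hx => hθσ x hx.1
            proj_smul := ?_ }⟩
  · rintro _ ⟨x, hx, rfl⟩
    exact (hRsub _ (hRsrc x hx.1)).1.1.2
  · intro g x hx hgx
    obtain ⟨w1, w2, w3⟩ := hV (show (g • x, x) ∈ V1 ×ˢ V2 from ⟨hgx.2.1, hx.2.2⟩) (g, x) rfl
    have h1 : k (g, x) • σ (p x) = σ (p (g • x)) := by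
      have h2 := hθσ x hx.1
      have h3 := hθσ (g • x) hgx.1
      simp only [k, mul_smul]
      rw [h2]
      nth_rewrite 2 [← h3]
      rw [inv_smul_smul]
    have h4 : R (ψ (k (g, x)), p x) = R (ψ 1, p (g • x)) := by
      rw [hRapp, hRapp]
      simp only [Ψ, Θ]
      rw [ψ.left_inv w1, hψ1, h1, one_smul]
    exact (congrArg Prod.snd (R.injOn w2 w3 h4)).symm


/-- The orbit space `Q / G`. The models of `Q` and `G` are recorded in the type, so that its smooth
structure can be an instance. -/
def OrbitSpace {E : Type*} [NormedAddCommGroup E] [NormedSpace ℝ E]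
    {H : Type*} [TopologicalSpace H] (_I : ModelWithCorners ℝ E H)
    (Q : Type*) [TopologicalSpace Q] [ChartedSpace H Q]
    {F : Type*} [NormedAddCommGroup F] [NormedSpace ℝ F]
    {H' : Type*} [TopologicalSpace H'] (_J : ModelWithCorners ℝ F H')
    (G : Type*) [TopologicalSpace G] [ChartedSpace H' G] [Group G] [MulAction G Q] : Type _ :=
  MulAction.orbitRel.Quotient G Q


instance OrbitSpace.instTopologicalSpace : TopologicalSpace (OrbitSpace I Q J G) :=
  inferInstanceAs (TopologicalSpace (MulAction.orbitRel.Quotient G Q))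

/-- The projection `Q → Q / G`. -/
def orbitProj (q : Q) : OrbitSpace I Q J G :=
  (Quotient.mk (MulAction.orbitRel G Q) q : MulAction.orbitRel.Quotient G Q)

variable {I J} in
theorem orbitProj_eq_iff {x y : Q} : orbitProj I J (G := G) x = orbitProj I J (G := G) y ↔ ∃ g : G, g • y = x :=
  Quotient.eq.trans (MulAction.orbitRel_apply.trans MulAction.mem_orbit_iff)

theorem orbitProj_smul (g : G) (x : Q) : orbitProj I J (G := G) (g • x) = orbitProj I J (G := G) x :=
  orbitProj_eq_iff.2 ⟨g, rfl⟩

theorem orbitProj_surjective : Function.Surjective (orbitProj I J : Q → OrbitSpace I Q J G) :=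
  Quot.mk_surjective

theorem isOpenQuotientMap_orbitProj [ContinuousConstSMul G Q] :
    IsOpenQuotientMap (orbitProj I J : Q → OrbitSpace I Q J G) :=
  MulAction.isOpenQuotientMap_quotientMk



variable {I J}

namespace LocalSlice

variable {q : Q} (s : LocalSlice I J G q)

/-- The coordinate on the orbit space defined by a slice. -/
def coord (b : OrbitSpace I Q J G) : QuotModel E F :=
  open Classical in
  if h : ∃ x ∈ s.dom, orbitProj I J (G := G) x = b then s.proj h.choose else 0

theorem coord_mk {x : Q} (hx : x ∈ s.dom) : s.coord (orbitProj I J x) = s.proj x := by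
  have h : ∃ y ∈ s.dom, orbitProj I J (G := G) y = orbitProj I J x := ⟨x, hx, rfl⟩
  rw [coord, dif_pos h]
  obtain ⟨h1, h2⟩ := h.choose_spec
  obtain ⟨g, hg⟩ := orbitProj_eq_iff.1 h2
  rw [← hg, s.proj_smul g x hx (by rw [hg]; exact h1)]

theorem mk_sec_proj {x : Q} (hx : x ∈ s.dom) :
    orbitProj I J (G := G) (s.sec (s.proj x)) = orbitProj I J x := by
  conv_rhs => rw [← s.transl_smul_sec x hx]
  rw [orbitProj_smul]

/-- The chart of the orbit space defined by a slice. -/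
def chart [ContinuousConstSMul G Q] : OpenPartialHomeomorph (OrbitSpace I Q J G) (QuotModel E F) where
  toFun := s.coord
  invFun y := orbitProj I J (s.sec y)
  source := orbitProj I J '' s.dom
  target := s.proj '' s.dom
  map_source' := by
    rintro _ ⟨x, hx, rfl⟩
    exact ⟨x, hx, (s.coord_mk hx).symm⟩
  map_target' := by
    rintro _ ⟨x, hx, rfl⟩
    exact ⟨x, hx, (s.mk_sec_proj hx).symm⟩
  left_inv' := by
    rintro _ ⟨x, hx, rfl⟩
    rw [s.coord_mk hx, s.mk_sec_proj hx]
  right_inv' := by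
    rintro _ ⟨x, hx, rfl⟩
    rw [s.mk_sec_proj hx, s.coord_mk hx]
  open_source := (isOpenQuotientMap_orbitProj I J).isOpenMap _ s.isOpen_dom
  open_target := s.isOpen_image
  continuousOn_toFun := by
    rintro _ ⟨x, hx, rfl⟩
    have h1 : ContinuousAt (s.coord ∘ orbitProj I J) x := by
      refine (s.proj_smooth.continuousOn.continuousAt (s.isOpen_dom.mem_nhds hx)).congr ?_
      filter_upwards [s.isOpen_dom.mem_nhds hx] with y hy
      exact (s.coord_mk hy).symm
    exact ((isOpenQuotientMap_orbitProj I J).continuousAt_comp_iff.1 h1).continuousWithinAt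
  continuousOn_invFun :=
    (isOpenQuotientMap_orbitProj I J).continuous.comp_continuousOn s.sec_smooth.continuousOn

end LocalSlice

section
variable [I.Boundaryless] [J.Boundaryless] [IsManifold I ∞ Q]
    [LieGroup J ∞ G] [ContMDiffSMul J I ∞ G Q] [ProperSMul G Q] [IsCancelSMul G Q]

/-- Charts of the orbit space of a smooth free proper action are given by local slices. -/
instance OrbitSpace.instChartedSpace : ChartedSpace (QuotModel E F) (OrbitSpace I Q J G) where
  atlas := {e | ∃ (q : Q) (s : LocalSlice I J G q), e = s.chart}
  chartAt b := (nonempty_localSlice I J (G := G) (orbitProj_surjective I J b).choose).some.chart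
  mem_chart_source b :=
    ⟨_, LocalSlice.mem_dom _, (orbitProj_surjective I J b).choose_spec⟩
  chart_mem_atlas _ := ⟨_, _, rfl⟩

theorem LocalSlice.contMDiffOn_coord {q : Q} (s : LocalSlice I J G q) :
    ContMDiffOn I 𝓘(ℝ, QuotModel E F) ∞ (fun x => s.coord (orbitProj I J x))
      (orbitProj I J (G := G) ⁻¹' (orbitProj I J '' s.dom)) := by
  rintro x ⟨y, hy, hyx⟩
  obtain ⟨g, hg⟩ := orbitProj_eq_iff.1 hyx
  have hgs : ContMDiff I I ∞ (fun z : Q => g • z) :=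
    (contMDiff_smul (I := J)).comp (contMDiff_const.prodMk contMDiff_id)
  have h1 : ContMDiffAt I 𝓘(ℝ, QuotModel E F) ∞ s.proj (g • x) := by
    rw [hg]; exact s.proj_smooth.contMDiffAt (s.isOpen_dom.mem_nhds hy)
  have h2 := h1.comp x hgs.contMDiffAt
  refine (h2.congr_of_eventuallyEq ?_).contMDiffWithinAt
  have h3 : ∀ᶠ z in 𝓝 x, g • z ∈ s.dom :=
    hgs.continuous.continuousAt.eventually (by
      change ∀ᶠ z in 𝓝 (g • x), z ∈ s.dom
      rw [hg]; exact s.isOpen_dom.mem_nhds hy)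
  filter_upwards [h3] with z hz
  simp only [Function.comp]
  rw [← orbitProj_smul I J g z, s.coord_mk hz]

instance OrbitSpace.instIsManifold : IsManifold 𝓘(ℝ, QuotModel E F) ∞ (OrbitSpace I Q J G) := by
  refine isManifold_of_contDiffOn _ _ _ ?_
  rintro _ _ ⟨q, s, rfl⟩ ⟨q', s', rfl⟩
  simp only [modelWithCornersSelf_coe, modelWithCornersSelf_coe_symm, Function.id_comp,
    Function.comp_id, preimage_id, range_id, inter_univ]
  refine (s'.contMDiffOn_coord.comp (s.sec_smooth.mono inter_subset_left) ?_).contDiffOn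
  rintro y ⟨hy1, hy2⟩
  exact hy2

variable (I J) in
theorem contMDiff_orbitProj :
    ContMDiff I 𝓘(ℝ, QuotModel E F) ∞ (orbitProj I J : Q → OrbitSpace I Q J G) := by
  intro x
  rw [contMDiffAt_iff_target]
  refine ⟨(isOpenQuotientMap_orbitProj I J).continuous.continuousAt, ?_⟩
  let s := (nonempty_localSlice I J (G := G) (orbitProj_surjective I J (orbitProj I J (G := G) x)).choose).some
  have hx : orbitProj I J (G := G) x ∈ orbitProj I J '' s.dom := mem_chart_source (QuotModel E F) (orbitProj I J (G := G) x)
  have hop : IsOpen (orbitProj I J (G := G) '' s.dom) := (isOpenQuotientMap_orbitProj I J).isOpenMap _ s.isOpen_dom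
  exact s.contMDiffOn_coord.contMDiffAt
    ((hop.preimage (isOpenQuotientMap_orbitProj I J).continuous).mem_nhds hx)

variable (I J) in
/-- The projection onto the orbit space has smooth local sections through every point. -/
theorem exists_local_section (q : Q) : ∃ τ : OrbitSpace I Q J G → Q,
    ContMDiffAt 𝓘(ℝ, QuotModel E F) I ∞ τ (orbitProj I J q) ∧ τ (orbitProj I J q) = q ∧
      ∀ᶠ b in 𝓝 (orbitProj I J (G := G) q), orbitProj I J (τ b) = b := by
  let s := (nonempty_localSlice I J (G := G) q).some
  have hq : orbitProj I J (G := G) q ∈ s.chart.source := ⟨q, s.mem_dom, rfl⟩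
  have hop : s.chart.source ∈ 𝓝 (orbitProj I J (G := G) q) := s.chart.open_source.mem_nhds hq
  have hs : s.chart ∈ atlas (QuotModel E F) (OrbitSpace I Q J G) := ⟨q, s, rfl⟩
  have hchart : ContMDiffOn 𝓘(ℝ, QuotModel E F) 𝓘(ℝ, QuotModel E F) ∞ s.chart s.chart.source :=
    contMDiffOn_of_mem_maximalAtlas (IsManifold.subset_maximalAtlas hs)
  have h1 : ContMDiffOn 𝓘(ℝ, QuotModel E F) I ∞ (fun b => s.sec (s.coord b)) s.chart.source :=
    s.sec_smooth.comp hchart (fun b hb => s.chart.map_source hb)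
  have hgs : ContMDiff I I ∞ (fun z : Q => s.transl q • z) :=
    (contMDiff_smul (I := J)).comp (contMDiff_const.prodMk contMDiff_id)
  refine ⟨fun b => s.transl q • s.sec (s.coord b),
    (hgs.comp_contMDiffOn h1).contMDiffAt hop, ?_, ?_⟩
  · simp only
    rw [s.coord_mk s.mem_dom, s.transl_smul_sec q s.mem_dom]
  · filter_upwards [hop] with b hb
    rw [orbitProj_smul]
    exact s.chart.left_inv hb

variable (I J) in
theorem mfderiv_orbitProj_surjective (q : Q) :
    Function.Surjective (mfderiv I 𝓘(ℝ, QuotModel E F)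
      (orbitProj I J : Q → OrbitSpace I Q J G) q) := by
  obtain ⟨τ, hτ, hτq, hτs⟩ := exists_local_section I J (G := G) q
  have hne : (∞ : ℕ∞ω) ≠ 0 := by simp
  have h1 : HasMFDerivAt I 𝓘(ℝ, QuotModel E F) (orbitProj I J : Q → OrbitSpace I Q J G)
      (τ (orbitProj I J q)) (mfderiv I 𝓘(ℝ, QuotModel E F)
        (orbitProj I J : Q → OrbitSpace I Q J G) (τ (orbitProj I J q))) :=
    ((contMDiff_orbitProj I J).mdifferentiable hne _).hasMFDerivAt
  have h2 := h1.comp _ (hτ.mdifferentiableAt hne).hasMFDerivAt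
  have h3 := hasMFDerivAt_unique h2 ((hasMFDerivAt_id _).congr_of_eventuallyEq hτs)
  have h4 : Function.Surjective (mfderiv I 𝓘(ℝ, QuotModel E F)
      (orbitProj I J : Q → OrbitSpace I Q J G) (τ (orbitProj I J q))) := fun w =>
    ⟨_, congrArg (fun f => f w) h3⟩
  rwa [hτq] at h4

variable (I J) in
/-- The infinitesimal generator `ξ_Q(q)`, as a linear function of `ξ`: the differential at the
identity of the orbit map `g ↦ g • q`. -/
def infGen (q : Q) : GroupLieAlgebra J G →L[ℝ] TangentSpace I q :=
  (mfderiv J I (fun g : G => g • q) 1 : F →L[ℝ] E)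

variable (I J) in
/-- `ξ_Q(q)` is the velocity at `t = 0` of `t ↦ c(t) • q`, for every curve `c` in `G` with `c(0) = e`
and velocity `ξ` at `0`, such as `c(t) = exp(t ξ)`. -/
theorem hasMFDerivAt_smul_infGen (q : Q) (ξ : F) (c : ℝ → G) (hc0 : c 0 = 1)
    (hc : HasMFDerivAt 𝓘(ℝ, ℝ) J c 0 ((1 : ℝ →L[ℝ] ℝ).smulRight ξ)) :
    HasMFDerivAt 𝓘(ℝ, ℝ) I (fun t => c t • q) 0
      ((1 : ℝ →L[ℝ] ℝ).smulRight (infGen I J (G := G) q ξ : E)) := by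
  have horb : ContMDiff J I ∞ (fun g : G => g • q) :=
    (contMDiff_smul (I := J)).comp (contMDiff_id.prodMk contMDiff_const)
  have h1 := ((horb.mdifferentiable (by simp)) (c 0)).hasMFDerivAt.comp 0 hc
  have h2 : ∀ g : G, g = 1 → ∀ T : ℝ →L[ℝ] E,
      T = (mfderiv J I (fun g : G => g • q) g : F →L[ℝ] E).comp
        ((1 : ℝ →L[ℝ] ℝ).smulRight ξ) →
      T = (1 : ℝ →L[ℝ] ℝ).smulRight (infGen I J (G := G) q ξ : E) := by
    rintro _ rfl T rfl
    refine ContinuousLinearMap.ext_ring ?_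
    have h3 : ∀ A : F →L[ℝ] E, (A.comp ((1 : ℝ →L[ℝ] ℝ).smulRight ξ)) 1 =
        ((1 : ℝ →L[ℝ] ℝ).smulRight (A ξ)) 1 := fun A => by simp
    exact h3 _
  exact (h2 (c 0) hc0 _ rfl) ▸ h1

variable (I J) in
theorem mfderiv_orbitProj_infGen (q : Q) (ξ : GroupLieAlgebra J G) :
    mfderiv I 𝓘(ℝ, QuotModel E F) (orbitProj I J : Q → OrbitSpace I Q J G) q
      (infGen I J q ξ) = 0 := by
  have hne : (∞ : ℕ∞ω) ≠ 0 := by simp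
  have horb : ContMDiff J I ∞ (fun g : G => g • q) :=
    (contMDiff_smul (I := J)).comp (contMDiff_id.prodMk contMDiff_const)
  have h1 : HasMFDerivAt I 𝓘(ℝ, QuotModel E F) (orbitProj I J : Q → OrbitSpace I Q J G)
      ((1 : G) • q) (mfderiv I 𝓘(ℝ, QuotModel E F)
        (orbitProj I J : Q → OrbitSpace I Q J G) ((1 : G) • q)) :=
    ((contMDiff_orbitProj I J).mdifferentiable hne _).hasMFDerivAt
  have h2 := h1.comp (1 : G) (horb.mdifferentiable hne 1).hasMFDerivAt
  have h3 := hasMFDerivAt_unique h2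
    ((hasMFDerivAt_const (I := J) (I' := 𝓘(ℝ, QuotModel E F))
      (orbitProj I J (G := G) q) (1 : G)).congr_of_eventuallyEq
      (Eventually.of_forall fun g => orbitProj_smul I J g q))
  have h4 := congrArg (fun f => f ξ) h3
  have h5 : ∀ y : Q, y = q → (mfderiv I 𝓘(ℝ, QuotModel E F)
      (orbitProj I J : Q → OrbitSpace I Q J G) y (infGen I J q ξ : E) : QuotModel E F) = 0 →
      (mfderiv I 𝓘(ℝ, QuotModel E F)
      (orbitProj I J : Q → OrbitSpace I Q J G) q (infGen I J q ξ : E) : QuotModel E F) = 0 := by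
    rintro _ rfl h; exact h
  exact h5 _ (one_smul G q) h4

variable (I J) in
/-- The vertical space, tangent to the orbit, is the kernel of the differential of the
projection. -/
theorem mfderiv_orbitProj_eq_zero_iff (q : Q) (v : TangentSpace I q) :
    mfderiv I 𝓘(ℝ, QuotModel E F) (orbitProj I J : Q → OrbitSpace I Q J G) q v = 0 ↔
      ∃ ξ : GroupLieAlgebra J G, infGen I J q ξ = v := by
  let T : E →L[ℝ] QuotModel E F :=
    mfderiv I 𝓘(ℝ, QuotModel E F) (orbitProj I J : Q → OrbitSpace I Q J G) q
  let A : F →L[ℝ] E := infGen I J (G := G) q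
  have hA : Function.Injective A := orbit_mfderiv_injective I J q
  have hT : Function.Surjective T := mfderiv_orbitProj_surjective I J q
  have hle : LinearMap.range (A : F →ₗ[ℝ] E) ≤ LinearMap.ker (T : E →ₗ[ℝ] QuotModel E F) := by
    rintro _ ⟨ξ, rfl⟩
    exact mfderiv_orbitProj_infGen I J q ξ
  have heq := Submodule.eq_of_le_of_finrank_le hle (by
    have h1 := LinearMap.finrank_range_add_finrank_ker (T : E →ₗ[ℝ] QuotModel E F)
    have h2 := LinearMap.finrank_range_of_inj (f := (A : F →ₗ[ℝ] E)) hA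
    have h3 : LinearMap.range (T : E →ₗ[ℝ] QuotModel E F) = ⊤ := LinearMap.range_eq_top.2 hT
    rw [h3, finrank_top, finrank_euclideanSpace_fin] at h1
    have h4 := LinearMap.finrank_le_finrank_of_injective (f := (A : F →ₗ[ℝ] E)) hA
    omega)
  have h5 : (v : E) ∈ LinearMap.range (A : F →ₗ[ℝ] E) ↔
    (v : E) ∈ LinearMap.ker (T : E →ₗ[ℝ] QuotModel E F) := by rw [heq]
  exact h5.symm

end

end Orbit

section ConjugateBundle

/-- The product `Q × G`, carrying the action `g • (q, w) = (g • q, g * w * g⁻¹)`. -/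
def ConjProd (Q : Type*) {F : Type*} [NormedAddCommGroup F] [NormedSpace ℝ F]
    {H' : Type*} [TopologicalSpace H'] (_J : ModelWithCorners ℝ F H') (G : Type*) : Type _ :=
  Q × G

variable {E : Type*} [NormedAddCommGroup E] [NormedSpace ℝ E] [FiniteDimensional ℝ E]
  {H : Type*} [TopologicalSpace H] (I : ModelWithCorners ℝ E H)
  {F : Type*} [NormedAddCommGroup F] [NormedSpace ℝ F] [FiniteDimensional ℝ F]
  {H' : Type*} [TopologicalSpace H'] (J : ModelWithCorners ℝ F H')
  {G : Type*} [TopologicalSpace G] [ChartedSpace H' G] [Group G]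
  {Q : Type*} [TopologicalSpace Q] [ChartedSpace H Q] [MulAction G Q]

namespace ConjProd

instance : TopologicalSpace (ConjProd Q J G) := inferInstanceAs (TopologicalSpace (Q × G))

instance : ChartedSpace (ModelProd H H') (ConjProd Q J G) :=
  inferInstanceAs (ChartedSpace (ModelProd H H') (Q × G))

instance [IsManifold I ∞ Q] [LieGroup J ∞ G] : IsManifold (I.prod J) ∞ (ConjProd Q J G) :=
  inferInstanceAs (IsManifold (I.prod J) ∞ (Q × G))

instance : MulAction G (ConjProd Q J G) where
  smul g x := (g • x.1, g * x.2 * g⁻¹)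
  one_smul x := Prod.ext (one_smul G x.1) (by change 1 * x.2 * 1⁻¹ = x.2; simp)
  mul_smul g h x := Prod.ext (mul_smul g h x.1) (by
    change g * h * x.2 * (g * h)⁻¹ = g * (h * x.2 * h⁻¹) * g⁻¹
    group)

variable {J} in
theorem smul_def (g : G) (x : ConjProd Q J G) :
    g • x = ((g • x.1, g * x.2 * g⁻¹) : Q × G) := rfl

instance [IsCancelSMul G Q] : IsCancelSMul G (ConjProd Q J G) where
  left_cancel' g _ _ h := (smul_left_cancel_iff g).1 h
  right_cancel' g h x hx := IsCancelSMul.right_cancel g h x.1 (congrArg Prod.fst hx)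

instance [LieGroup J ∞ G] [ContMDiffSMul J I ∞ G Q] :
    ContMDiffSMul J (I.prod J) ∞ G (ConjProd Q J G) where
  contMDiff_smul := by
    have h1 : ContMDiff (J.prod (I.prod J)) I ∞ (fun p : G × (Q × G) => p.1 • p.2.1) :=
      (contMDiff_smul (I := J) (I' := I)).comp (contMDiff_fst.prodMk (contMDiff_fst.comp contMDiff_snd))
    have h2 : ContMDiff (J.prod (I.prod J)) J ∞ (fun p : G × (Q × G) => p.1 * p.2.2 * p.1⁻¹) :=
      (contMDiff_fst.mul (contMDiff_snd.comp contMDiff_snd)).mul contMDiff_fst.inv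
    exact h1.prodMk h2

instance [LieGroup J ∞ G] [ProperSMul G Q] : ProperSMul G (ConjProd Q J G) := by
  have : IsTopologicalGroup G := topologicalGroup_of_lieGroup J ∞
  have : T2Space H' := J.isClosedEmbedding.isEmbedding.t2Space
  have : T1Space G := ChartedSpace.t1Space H' G
  rw [properSMul_iff_continuousSMul_ultrafilter_tendsto]
  have hc : Continuous (fun p : G × (Q × G) => ((p.1 • p.2.1, p.1 * p.2.2 * p.1⁻¹) : Q × G)) := by
    fun_prop
  refine ⟨⟨hc⟩, ?_⟩
  intro (𝒰 : Ultrafilter (G × (Q × G))) (x₁ : Q × G) (x₂ : Q × G) h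
  replace h : Tendsto (fun p : G × (Q × G) => (((p.1 • p.2.1, p.1 * p.2.2 * p.1⁻¹), p.2) :
    (Q × G) × (Q × G))) 𝒰 (𝓝 (x₁, x₂)) := h
  have h1 : Tendsto (fun p : G × (Q × G) => p.1 • p.2.1) 𝒰 (𝓝 x₁.1) :=
    (continuous_fst.tendsto (X := Q × G) x₁).comp ((continuous_fst.tendsto _).comp h)
  have h2 : Tendsto (fun p : G × (Q × G) => p.2) 𝒰 (𝓝 (x₂ : Q × G)) :=
    (continuous_snd.tendsto _).comp h
  have h3 : Tendsto (fun p : G × (Q × G) => p.1 * p.2.2 * p.1⁻¹) 𝒰 (𝓝 x₁.2) :=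
    (continuous_snd.tendsto (X := Q × G) x₁).comp ((continuous_fst.tendsto _).comp h)
  obtain ⟨g, hg1, hg2⟩ := (properSMul_iff_continuousSMul_ultrafilter_tendsto.1
    (inferInstanceAs (ProperSMul G Q))).2 (𝒰.map fun p : G × (Q × G) => (p.1, p.2.1)) x₁.1 x₂.1
    (by
      rw [Ultrafilter.coe_map, tendsto_map'_iff]
      exact h1.prodMk_nhds ((continuous_fst.tendsto _).comp h2))
  rw [Ultrafilter.coe_map, tendsto_map'_iff] at hg2
  have h4 : Tendsto (fun p : G × (Q × G) => p.1) 𝒰 (𝓝 g) := hg2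
  have h5 := (h4.mul ((continuous_snd.tendsto _).comp h2)).mul h4.inv
  refine ⟨g, Prod.ext hg1 ?_, h4⟩
  exact tendsto_nhds_unique h5 h3

end ConjProd

/-- The associated conjugate bundle `G̃ = (Q × G) / G`. -/
abbrev ConjBundle (Q : Type*) [TopologicalSpace Q] [ChartedSpace H Q] (G : Type*)
    [TopologicalSpace G] [ChartedSpace H' G] [Group G] [MulAction G Q] : Type _ :=
  OrbitSpace (I.prod J) (ConjProd Q J G) J G

/-- The quotient map `ρ : Q × G → G̃`. -/
def conjProj (x : Q × G) : ConjBundle I J Q G :=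
  orbitProj (I.prod J) J (G := G) (x : ConjProd Q J G)

end ConjugateBundle

section Mechanics

variable {E : Type*} [NormedAddCommGroup E] [NormedSpace ℝ E]
  {H : Type*} [TopologicalSpace H] (I : ModelWithCorners ℝ E H)
  (Q : Type*) [TopologicalSpace Q] [ChartedSpace H Q]

/-- A discrete mechanical system on the configuration manifold `Q`: a smooth discrete
Lagrangian `L_d : Q × Q → ℝ`. -/
structure DiscreteMechanicalSystem where
  lagrangian : Q × Q → ℝ
  smooth : ContMDiff (I.prod I) 𝓘(ℝ, ℝ) ∞ lagrangian

variable {Q}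
variable {E₁ : Type*} [NormedAddCommGroup E₁] [NormedSpace ℝ E₁]
  {H₁ : Type*} [TopologicalSpace H₁] (I₁ : ModelWithCorners ℝ E₁ H₁)
  {E₂ : Type*} [NormedAddCommGroup E₂] [NormedSpace ℝ E₂]
  {H₂ : Type*} [TopologicalSpace H₂] (I₂ : ModelWithCorners ℝ E₂ H₂)
  {M : Type*} [TopologicalSpace M] [ChartedSpace H M]
  {M₁ : Type*} [TopologicalSpace M₁] [ChartedSpace H₁ M₁]
  {M₂ : Type*} [TopologicalSpace M₂] [ChartedSpace H₂ M₂]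

/-- `D₁ f = T f ∘ j₁`, where `j₁ (δx) = (δx, 0)`. -/
def partialD₁ (f : M × M₁ → M₂) (x : M × M₁) : TangentSpace I x.1 →L[ℝ] TangentSpace I₂ (f x) :=
  (mfderiv (I.prod I₁) I₂ f x : E × E₁ →L[ℝ] E₂).comp (ContinuousLinearMap.inl ℝ E E₁)

/-- `D₂ f = T f ∘ j₂`, where `j₂ (δy) = (0, δy)`. -/
def partialD₂ (f : M × M₁ → M₂) (x : M × M₁) : TangentSpace I₁ x.2 →L[ℝ] TangentSpace I₂ (f x) :=
  (mfderiv (I.prod I₁) I₂ f x : E × E₁ →L[ℝ] E₂).comp (ContinuousLinearMap.inr ℝ E E₁)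

/-- The differential at `x` of a real function with respect to the first of three factors. -/
def diff₁ (f : M × M₁ × M₂ → ℝ) (x : M × M₁ × M₂) : TangentSpace I x.1 →L[ℝ] ℝ :=
  (mfderiv (I.prod (I₁.prod I₂)) 𝓘(ℝ, ℝ) f x : E × E₁ × E₂ →L[ℝ] ℝ).comp
    (ContinuousLinearMap.inl ℝ E (E₁ × E₂))

/-- The differential at `x` of a real function with respect to the second of three factors. -/
def diff₂ (f : M × M₁ × M₂ → ℝ) (x : M × M₁ × M₂) : TangentSpace I₁ x.2.1 →L[ℝ] ℝ :=
  (mfderiv (I.prod (I₁.prod I₂)) 𝓘(ℝ, ℝ) f x : E × E₁ × E₂ →L[ℝ] ℝ).comp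
    ((ContinuousLinearMap.inr ℝ E (E₁ × E₂)).comp (ContinuousLinearMap.inl ℝ E₁ E₂))

/-- The differential at `x` of a real function with respect to the third of three factors. -/
def diff₃ (f : M × M₁ × M₂ → ℝ) (x : M × M₁ × M₂) : TangentSpace I₂ x.2.2 →L[ℝ] ℝ :=
  (mfderiv (I.prod (I₁.prod I₂)) 𝓘(ℝ, ℝ) f x : E × E₁ × E₂ →L[ℝ] ℝ).comp
    ((ContinuousLinearMap.inr ℝ E (E₁ × E₂)).comp (ContinuousLinearMap.inr ℝ E₁ E₂))

namespace DiscreteMechanicalSystem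

variable {I} (S : DiscreteMechanicalSystem I Q) {N : ℕ}

/-- The discrete action `S_d(q.) = ∑_{k=0}^{N-1} L_d(q_k, q_{k+1})` of `q. = (q_0, …, q_N)`. -/
def action (q : Fin (N + 1) → Q) : ℝ := ∑ k : Fin N, S.lagrangian (q k.castSucc, q k.succ)

/-- The discrete Hamilton principle: the differential of the discrete action, a function on the
product manifold `Q^{N+1}`, vanishes on all infinitesimal variations with fixed endpoints. -/
def HamiltonPrinciple (q : Fin (N + 1) → Q) : Prop :=
  ∀ δq : (k : Fin (N + 1)) → TangentSpace I (q k), δq 0 = 0 → δq (Fin.last N) = 0 →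
    mfderiv (ModelWithCorners.pi fun _ : Fin (N + 1) => I) 𝓘(ℝ, ℝ) S.action q δq = (0 : ℝ)

/-- The covector `D₂ L_d(q₀, q₁) + D₁ L_d(q₁, q₂) ∈ T*_{q₁} Q`. -/
def eulerLagrangeCovector (q₀ q₁ q₂ : Q) : TangentSpace I q₁ →L[ℝ] ℝ :=
  let α : TangentSpace I q₁ →L[ℝ] ℝ := partialD₂ I I 𝓘(ℝ, ℝ) S.lagrangian (q₀, q₁)
  let β : TangentSpace I q₁ →L[ℝ] ℝ := partialD₁ I I 𝓘(ℝ, ℝ) S.lagrangian (q₁, q₂)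
  α + β

/-- The discrete Euler–Lagrange equations
`D₂ L_d(q_{k-1}, q_k) + D₁ L_d(q_k, q_{k+1}) = 0 ∈ T*_{q_k} Q` for `k = 1, …, N - 1`. -/
def EulerLagrange (q : Fin (N + 1) → Q) : Prop :=
  ∀ (k : ℕ) (_ : 1 ≤ k) (_ : k < N),
    S.eulerLagrangeCovector (q ⟨k - 1, by omega⟩) (q ⟨k, by omega⟩) (q ⟨k + 1, by omega⟩) = 0

/-- `G` is a symmetry group: `L_d` is invariant under the diagonal action. -/
def IsSymmetryGroup (G : Type*) [Group G] [MulAction G Q] : Prop :=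
  ∀ (g : G) (q₀ q₁ : Q), S.lagrangian (g • q₀, g • q₁) = S.lagrangian (q₀, q₁)

end DiscreteMechanicalSystem

end Mechanics

section Reduction

variable {E : Type*} [NormedAddCommGroup E] [NormedSpace ℝ E] [FiniteDimensional ℝ E]
  {H : Type*} [TopologicalSpace H] (I : ModelWithCorners ℝ E H) [I.Boundaryless]
  (Q : Type*) [TopologicalSpace Q] [ChartedSpace H Q] [IsManifold I ∞ Q]
  {F : Type*} [NormedAddCommGroup F] [NormedSpace ℝ F] [FiniteDimensional ℝ F]
  {H' : Type*} [TopologicalSpace H'] (J : ModelWithCorners ℝ F H') [J.Boundaryless]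
  (G : Type*) [TopologicalSpace G] [ChartedSpace H' G] [Group G] [LieGroup J ∞ G]
  [MulAction G Q] [ContMDiffSMul J I ∞ G Q] [ProperSMul G Q] [IsCancelSMul G Q]

/-- An affine discrete connection on `π : Q → Q / G`, with level function `γ`, whose domain is the
whole space: a `G`-invariant embedded submanifold `Hor ⊆ Q × Q` which contains
`{(q, γ(q) • q)}`, and on which `id × π` restricts to an injective local diffeomorphism onto
`Q × Q / G`. -/
structure AffineDiscreteConnection where
  /-- The level function `γ`. -/
  level : Q → G
  level_smooth : ContMDiff I J ∞ level
  level_smul : ∀ (g : G) (q : Q), level (g • q) = g * level q * g⁻¹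
  /-- The submanifold `Hor`. -/
  hor : Set (Q × Q)
  dim : ℕ
  [chartedSpace : ChartedSpace (EuclideanSpace ℝ (Fin dim)) hor]
  [isManifold : IsManifold (𝓡 dim) ∞ hor]
  isSmoothEmbedding :
    Manifold.IsSmoothEmbedding (𝓡 dim) (I.prod I) ∞ (Subtype.val : hor → Q × Q)
  level_mem : ∀ q : Q, (q, level q • q) ∈ hor
  smul_mem : ∀ (g : G) (q₀ q₁ : Q), (q₀, q₁) ∈ hor → (g • q₀, g • q₁) ∈ hor
  isLocalDiffeomorph : IsLocalDiffeomorph (𝓡 dim) (I.prod 𝓘(ℝ, QuotModel E F)) ∞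
    (fun x : hor => ((x.1.1, orbitProj I J x.1.2) : Q × OrbitSpace I Q J G))
  injective : Function.Injective
    (fun x : hor => ((x.1.1, orbitProj I J x.1.2) : Q × OrbitSpace I Q J G))
  /-- The connection is defined on the whole space. -/
  surjective : Function.Surjective
    (fun x : hor => ((x.1.1, orbitProj I J x.1.2) : Q × OrbitSpace I Q J G))

/-- A principal connection on `π : Q → Q / G`, given by its connection form
`𝔄 : TQ → 𝔤`. -/
structure PrincipalConnection where
  form : (q : Q) → TangentSpace I q →L[ℝ] GroupLieAlgebra J G
  smooth : ContMDiff (M' := F) I.tangent 𝓘(ℝ, F) ∞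
    (fun v : TangentBundle I Q => form v.proj v.snd)
  form_infGen : ∀ (q : Q) (ξ : GroupLieAlgebra J G), form q (infGen I J q ξ) = ξ
  /-- Equivariance: `𝔄(g • q)(T l_g v) = Ad_g (𝔄(q)(v))`. -/
  form_smul : ∀ (g : G) (q : Q) (v : TangentSpace I q),
    (form (g • q) (mfderiv I I (fun x : Q => g • x) q v) : F) =
      mfderiv J J (fun x : G => g * x * g⁻¹) 1 (form q v)

variable {I Q J G}

namespace PrincipalConnection

variable (𝔄 : PrincipalConnection I Q J G)

/-- The horizontal subspace `Hor_𝔄(q) ⊆ T_q Q`. -/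
def horizontal (q : Q) : Submodule ℝ (TangentSpace I q) :=
  LinearMap.ker (𝔄.form q).toLinearMap

/-- The restriction of `T_q π` to the horizontal subspace is an isomorphism. -/
theorem bijective_mfderiv_horizontal (q : Q) : Function.Bijective
    ((mfderiv I 𝓘(ℝ, QuotModel E F) (orbitProj I J : Q → OrbitSpace I Q J G) q).toLinearMap.domRestrict
      (𝔄.horizontal q)) := by
  constructor
  · rw [injective_iff_map_eq_zero]
    rintro ⟨v, hv⟩ h
    obtain ⟨ξ, rfl⟩ := (mfderiv_orbitProj_eq_zero_iff I J (G := G) q v).1 h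
    have h1 : 𝔄.form q (infGen I J q ξ) = 0 := hv
    rw [𝔄.form_infGen] at h1
    subst h1
    exact Subtype.ext (map_zero _)
  · intro w
    obtain ⟨v, hv⟩ := mfderiv_orbitProj_surjective I J (G := G) q w
    refine ⟨⟨v - infGen I J q (𝔄.form q v), ?_⟩, ?_⟩
    · change 𝔄.form q (v - infGen I J q (𝔄.form q v)) = 0
      rw [map_sub, 𝔄.form_infGen, sub_self]
    · change mfderiv I 𝓘(ℝ, QuotModel E F) (orbitProj I J : Q → OrbitSpace I Q J G) q
        (v - infGen I J q (𝔄.form q v)) = w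
      rw [map_sub, mfderiv_orbitProj_infGen, sub_zero, hv]

/-- The horizontal lift `h^q : T_{π(q)}(Q / G) → T_q Q`, inverse to the restriction of `T_q π` to
the horizontal subspace. -/
def horLift (q : Q) :
    TangentSpace 𝓘(ℝ, QuotModel E F) (orbitProj I J (G := G) q) →L[ℝ] TangentSpace I q :=
  let f : QuotModel E F →ₗ[ℝ] E := (𝔄.horizontal q).subtype.comp
    (LinearEquiv.ofBijective _ (𝔄.bijective_mfderiv_horizontal q)).symm.toLinearMap
  let h : QuotModel E F →L[ℝ] E := LinearMap.toContinuousLinearMap f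
  h

theorem horLift_eq_iff (q : Q)
    (w : TangentSpace 𝓘(ℝ, QuotModel E F) (orbitProj I J (G := G) q)) (v : TangentSpace I q) :
    𝔄.horLift q w = v ↔ v ∈ 𝔄.horizontal q ∧
      mfderiv I 𝓘(ℝ, QuotModel E F) (orbitProj I J : Q → OrbitSpace I Q J G) q v = w := by
  let e := LinearEquiv.ofBijective _ (𝔄.bijective_mfderiv_horizontal q)
  have h1 : 𝔄.horLift q w = (e.symm w : TangentSpace I q) := rfl
  constructor
  · rintro rfl
    exact ⟨by rw [h1]; exact (e.symm w).2, e.apply_symm_apply w⟩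
  · rintro ⟨hv, hw⟩
    have h2 : e ⟨v, hv⟩ = w := hw
    rw [h1, ← h2, e.symm_apply_apply]

end PrincipalConnection

namespace AffineDiscreteConnection

variable (A : AffineDiscreteConnection I Q J G)

attribute [instance] AffineDiscreteConnection.chartedSpace AffineDiscreteConnection.isManifold

theorem existsUnique_form (q₀ q₁ : Q) : ∃! g : G, (q₀, g⁻¹ • q₁) ∈ A.hor := by
  obtain ⟨⟨⟨a, b⟩, hab⟩, h⟩ := A.surjective (q₀, orbitProj I J q₁)
  simp only [Prod.mk.injEq] at h
  obtain ⟨rfl, h⟩ := h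
  obtain ⟨g, hg⟩ := orbitProj_eq_iff.1 h
  refine ⟨g⁻¹, by simpa [hg] using hab, fun k hk => ?_⟩
  have h1 := @A.injective ⟨_, hk⟩ ⟨_, hab⟩ (Prod.ext rfl
    ((orbitProj_smul I J k⁻¹ q₁).trans h.symm))
  have h2 : k⁻¹ • q₁ = b := congrArg (fun x => x.1.2) h1
  rw [← hg] at h2
  rw [← IsCancelSMul.right_cancel _ _ _ h2, inv_inv]

/-- The affine discrete connection form `𝒜_d : Q × Q → G`: `𝒜_d(q₀, q₁)` is the unique `g` such
that `(q₀, g⁻¹ • q₁) ∈ Hor`. -/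
def form (x : Q × Q) : G := (A.existsUnique_form x.1 x.2).choose

theorem form_eq_iff (q₀ q₁ : Q) (g : G) : A.form (q₀, q₁) = g ↔ (q₀, g⁻¹ • q₁) ∈ A.hor := by
  obtain ⟨h1, h2⟩ := (A.existsUnique_form q₀ q₁).choose_spec
  exact ⟨fun h => by rw [← h]; exact h1, fun h => (h2 g h).symm⟩

theorem existsUnique_lift (q₀ : Q) (τ₁ : OrbitSpace I Q J G) :
    ∃! q₁ : Q, (q₀, q₁) ∈ A.hor ∧ orbitProj I J q₁ = τ₁ := by
  obtain ⟨⟨⟨a, b⟩, hab⟩, h⟩ := A.surjective (q₀, τ₁)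
  simp only [Prod.mk.injEq] at h
  obtain ⟨rfl, h⟩ := h
  refine ⟨b, ⟨hab, h⟩, fun c hc => ?_⟩
  have h1 := @A.injective ⟨_, hc.1⟩ ⟨_, hab⟩ (Prod.ext rfl (hc.2.trans h.symm))
  exact congrArg (fun x => x.1.2) h1

/-- The second component of the discrete horizontal lift: `lift q₀ τ₁` is the unique `q₁` such that
`(q₀, q₁) ∈ Hor` and `π(q₁) = τ₁`. -/
def lift (q₀ : Q) (τ₁ : OrbitSpace I Q J G) : Q := (A.existsUnique_lift q₀ τ₁).choose

theorem lift_eq_iff (q₀ : Q) (τ₁ : OrbitSpace I Q J G) (q₁ : Q) :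
    A.lift q₀ τ₁ = q₁ ↔ (q₀, q₁) ∈ A.hor ∧ orbitProj I J q₁ = τ₁ := by
  obtain ⟨h1, h2⟩ := (A.existsUnique_lift q₀ τ₁).choose_spec
  exact ⟨fun h => by rw [← h]; exact h1, fun h => (h2 q₁ h).symm⟩

theorem lift_smul (g : G) (q₀ : Q) (τ₁ : OrbitSpace I Q J G) :
    A.lift (g • q₀) τ₁ = g • A.lift q₀ τ₁ := by
  obtain ⟨h1, h2⟩ := (A.lift_eq_iff q₀ τ₁ _).1 rfl
  exact (A.lift_eq_iff _ _ _).2 ⟨A.smul_mem _ _ _ h1, (orbitProj_smul I J g _).trans h2⟩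

/-- The bijection `Φ̃(q₀, q₁) = (q₀, 𝒜_d(q₀, q₁), π(q₁))` from `Q × Q` to `Q × G × Q / G`. -/
def prodEquiv : Q × Q ≃ Q × G × OrbitSpace I Q J G where
  toFun x := (x.1, A.form x, orbitProj I J x.2)
  invFun x := (x.1, x.2.1 • A.lift x.1 x.2.2)
  left_inv := by
    rintro ⟨q₀, q₁⟩
    have h1 : A.lift q₀ (orbitProj I J q₁) = (A.form (q₀, q₁))⁻¹ • q₁ :=
      (A.lift_eq_iff _ _ _).2 ⟨(A.form_eq_iff q₀ q₁ _).1 rfl, orbitProj_smul I J _ _⟩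
    simp [h1]
  right_inv := by
    rintro ⟨q₀, w, τ⟩
    obtain ⟨h1, h2⟩ := (A.lift_eq_iff q₀ τ _).1 rfl
    have h3 : A.form (q₀, w • A.lift q₀ τ) = w := (A.form_eq_iff _ _ _).2 (by simpa using h1)
    simp [h3, orbitProj_smul, h2]

variable (S : DiscreteMechanicalSystem I Q)

/-- `Ľ_d = L_d ∘ Φ̃⁻¹ : Q × G × Q / G → ℝ`. -/
def liftedLagrangian (x : Q × G × OrbitSpace I Q J G) : ℝ := S.lagrangian (A.prodEquiv.symm x)

/-- The reduced Lagrangian `L̂_d : G̃ × Q / G → ℝ`, with `L̂_d(ρ(q, w), τ) = Ľ_d(q, w, τ)`. -/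
def reducedLagrangian (hS : S.IsSymmetryGroup G) (x : ConjBundle I J Q G × OrbitSpace I Q J G) : ℝ :=
  Quotient.lift (s := MulAction.orbitRel G (ConjProd Q J G))
    (fun y : ConjProd Q J G => A.liftedLagrangian S (y.1, y.2, x.2)) (by
      intro y z hyz
      obtain ⟨g, rfl⟩ := MulAction.mem_orbit_iff.1 (MulAction.orbitRel_apply.1 hyz)
      change S.lagrangian (g • z.1, (g * z.2 * g⁻¹) • A.lift (g • z.1) x.2) =
        S.lagrangian (z.1, z.2 • A.lift z.1 x.2)
      rw [A.lift_smul, smul_smul, inv_mul_cancel_right, mul_smul, hS]) x.1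

theorem reducedLagrangian_conjProj (hS : S.IsSymmetryGroup G) (q : Q) (w : G)
    (τ : OrbitSpace I Q J G) :
    A.reducedLagrangian S hS (conjProj I J (q, w), τ) = A.liftedLagrangian S (q, w, τ) := rfl

variable {N : ℕ}

/-- The reduced discrete action `Ŝ_d(v., τ.) = ∑_{k=0}^{N-1} L̂_d(v_k, τ_{k+1})`. -/
def reducedAction (hS : S.IsSymmetryGroup G)
    (x : Fin N → ConjBundle I J Q G × OrbitSpace I Q J G) : ℝ :=
  ∑ k : Fin N, A.reducedLagrangian S hS (x k)

/-- The reduced curve `((v_0, τ_1), …, (v_{N-1}, τ_N))` of `q.`, where `τ_k = π(q_k)` and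
`v_k = ρ(q_k, w_k)`, `w_k = 𝒜_d(q_k, q_{k+1})`. -/
def reducedCurve (q : Fin (N + 1) → Q) (k : Fin N) : ConjBundle I J Q G × OrbitSpace I Q J G :=
  (conjProj I J (q k.castSucc, A.form (q k.castSucc, q k.succ)), orbitProj I J (q k.succ))

/-- `T_{(q₀, w)} ρ (δq₀, T_{(q₀, q₁)} 𝒜_d (δq₀, δq₁))`, where `w = 𝒜_d(q₀, q₁)`. -/
def reducedVariation (q₀ q₁ : Q) (δq₀ : TangentSpace I q₀) (δq₁ : TangentSpace I q₁) :
    TangentSpace 𝓘(ℝ, QuotModel (E × F) F) (conjProj I J (q₀, A.form (q₀, q₁))) :=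
  mfderiv (I.prod J) 𝓘(ℝ, QuotModel (E × F) F) (conjProj I J : Q × G → ConjBundle I J Q G)
    (q₀, A.form (q₀, q₁)) (δq₀, mfderiv (I.prod I) J A.form (q₀, q₁) (δq₀, δq₁))

/-- The reduced variational principle. -/
def ReducedVariationalPrinciple (𝔄 : PrincipalConnection I Q J G) (hS : S.IsSymmetryGroup G)
    (q : Fin (N + 1) → Q) : Prop :=
  ∀ (δτ : (k : Fin (N + 1)) →
      TangentSpace 𝓘(ℝ, QuotModel E F) (orbitProj I J (G := G) (q k)))
    (ξ : Fin (N + 1) → GroupLieAlgebra J G)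
    (δv : (k : Fin N) → TangentSpace 𝓘(ℝ, QuotModel (E × F) F)
      (conjProj I J (q k.castSucc, A.form (q k.castSucc, q k.succ)))),
    (∀ k : Fin N, δv k =
      A.reducedVariation (q k.castSucc) (q k.succ)
          (𝔄.horLift (q k.castSucc) (δτ k.castSucc)) (𝔄.horLift (q k.succ) (δτ k.succ)) +
        A.reducedVariation (q k.castSucc) (q k.succ)
          (infGen I J (q k.castSucc) (ξ k.castSucc)) (infGen I J (q k.succ) (ξ k.succ))) →
    δτ 0 = 0 → δτ (Fin.last N) = 0 → ξ 0 = 0 → ξ (Fin.last N) = 0 →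
    mfderiv (ModelWithCorners.pi fun _ : Fin N =>
        𝓘(ℝ, QuotModel (E × F) F).prod 𝓘(ℝ, QuotModel E F)) 𝓘(ℝ, ℝ)
      (A.reducedAction S hS) (A.reducedCurve q) (fun k => (δv k, δτ k.succ)) = (0 : ℝ)

/-- The covector `φ ∈ T*_{τ₁}(Q / G)`, for consecutive points `q₀, q₁, q₂` with
`w₀ = 𝒜_d(q₀, q₁)`, `w₁ = 𝒜_d(q₁, q₂)`, `τ₁ = π(q₁)`, `τ₂ = π(q₂)`:
`φ = D₁ Ľ_d(q₁, w₁, τ₂) ∘ h^{q₁} + D₃ Ľ_d(q₀, w₀, τ₁)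
  + D₂ Ľ_d(q₁, w₁, τ₂) ∘ D₁ 𝒜_d(q₁, q₂) ∘ h^{q₁} + D₂ Ľ_d(q₀, w₀, τ₁) ∘ D₂ 𝒜_d(q₀, q₁) ∘ h^{q₁}`. -/
def horizontalCovector (𝔄 : PrincipalConnection I Q J G) (q₀ q₁ q₂ : Q) :
    TangentSpace 𝓘(ℝ, QuotModel E F) (orbitProj I J (G := G) q₁) →L[ℝ] ℝ :=
  (diff₁ I J 𝓘(ℝ, QuotModel E F) (A.liftedLagrangian S)
      (q₁, A.form (q₁, q₂), orbitProj I J q₂)).comp (𝔄.horLift q₁) +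
    diff₃ I J 𝓘(ℝ, QuotModel E F) (A.liftedLagrangian S)
      (q₀, A.form (q₀, q₁), orbitProj I J q₁) +
    ((diff₂ I J 𝓘(ℝ, QuotModel E F) (A.liftedLagrangian S)
      (q₁, A.form (q₁, q₂), orbitProj I J q₂)).comp
        (partialD₁ I I J A.form (q₁, q₂))).comp (𝔄.horLift q₁) +
    ((diff₂ I J 𝓘(ℝ, QuotModel E F) (A.liftedLagrangian S)
      (q₀, A.form (q₀, q₁), orbitProj I J q₁)).comp
        (partialD₂ I I J A.form (q₀, q₁))).comp (𝔄.horLift q₁)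

/-- For `α ∈ T*_w G`, the right translate `α w⁻¹ ∈ T*_e G = 𝔤*`, that is `ξ ↦ α (T_e R_w ξ)`. -/
def rightTranslate (w : G) (α : TangentSpace J w →L[ℝ] ℝ) : GroupLieAlgebra J G →L[ℝ] ℝ :=
  (α : F →L[ℝ] ℝ).comp (mfderiv J J (fun x : G => x * w) 1 : F →L[ℝ] F)

/-- The covector `ψ = D₂ Ľ_d(q₀, w₀, τ₁) w₀⁻¹ - D₂ Ľ_d(q₁, w₁, τ₂) w₁⁻¹ ∈ 𝔤*`, with the notation
of `horizontalCovector`. -/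
def verticalCovector (q₀ q₁ q₂ : Q) : GroupLieAlgebra J G →L[ℝ] ℝ :=
  rightTranslate (A.form (q₀, q₁)) (diff₂ I J 𝓘(ℝ, QuotModel E F) (A.liftedLagrangian S)
      (q₀, A.form (q₀, q₁), orbitProj I J q₁)) -
    rightTranslate (A.form (q₁, q₂)) (diff₂ I J 𝓘(ℝ, QuotModel E F) (A.liftedLagrangian S)
      (q₁, A.form (q₁, q₂), orbitProj I J q₂))

/-- The reduced equations of motion: `φ = 0` and `ψ = 0` for `k = 1, …, N - 1`. -/
def ReducedEquations (𝔄 : PrincipalConnection I Q J G) (q : Fin (N + 1) → Q) : Prop :=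
  ∀ (k : ℕ) (_ : 1 ≤ k) (_ : k < N),
    A.horizontalCovector S 𝔄 (q ⟨k - 1, by omega⟩) (q ⟨k, by omega⟩) (q ⟨k + 1, by omega⟩) = 0 ∧
    ∀ ξ : GroupLieAlgebra J G,
      A.verticalCovector S (q ⟨k - 1, by omega⟩) (q ⟨k, by omega⟩) (q ⟨k + 1, by omega⟩) ξ = 0

end AffineDiscreteConnection

end Reduction

end DMSReduction

end

namespace DMSReduction

section Calculus

variable {E : Type*} [NormedAddCommGroup E] [NormedSpace ℝ E]
  {H : Type*} [TopologicalSpace H] {I : ModelWithCorners ℝ E H}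
  {M : Type*} [TopologicalSpace M] [ChartedSpace H M]
  {E' : Type*} [NormedAddCommGroup E'] [NormedSpace ℝ E']
  {H' : Type*} [TopologicalSpace H'] {I' : ModelWithCorners ℝ E' H'}
  {M' : Type*} [TopologicalSpace M'] [ChartedSpace H' M']
  {E'' : Type*} [NormedAddCommGroup E''] [NormedSpace ℝ E'']
  {H'' : Type*} [TopologicalSpace H''] {I'' : ModelWithCorners ℝ E'' H''}
  {M'' : Type*} [TopologicalSpace M''] [ChartedSpace H'' M'']

/-- The chain rule, with the tangent spaces identified with the model spaces. -/
theorem hasMFDerivAt_comp_of_eq {g : M' → M''} {f : M → M'} {x : M} {y : M'}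
    {g' : E' →L[ℝ] E''} {f' : E →L[ℝ] E'} (hg : HasMFDerivAt I' I'' g y g')
    (hf : HasMFDerivAt I I' f x f') (hy : f x = y) :
    HasMFDerivAt I I'' (fun z => g (f z)) x (g'.comp f') := by
  subst hy
  exact hg.comp x hf

/-- The evaluation maps of a power of a manifold have the coordinate projections as differentials. -/
theorem hasMFDerivAt_eval {ι : Type*} [Fintype ι] (i : ι) (x : ι → M) :
    HasMFDerivAt (ModelWithCorners.pi fun _ : ι => I) I (fun y : ι → M => y i) x
      (ContinuousLinearMap.proj i : (ι → E) →L[ℝ] E) := by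
  refine ⟨(continuous_apply i).continuousAt, ?_⟩
  have h1 : HasFDerivWithinAt (fun z : ι → E => z i)
      (ContinuousLinearMap.proj i : (ι → E) →L[ℝ] E)
      (range (ModelWithCorners.pi fun _ : ι => I))
      (extChartAt (ModelWithCorners.pi fun _ : ι => I) x x) :=
    (ContinuousLinearMap.proj (R := ℝ) (φ := fun _ : ι => E) i).hasFDerivWithinAt
  refine h1.congr_of_eventuallyEq ?_ ?_
  swap
  · exact (extChartAt I (x i)).right_inv (mem_extChartAt_target (x i))
  filter_upwards [extChartAt_target_mem_nhdsWithin (I := ModelWithCorners.pi fun _ : ι => I) x]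
    with z hz
  have h2 : z i ∈ (extChartAt I (x i)).target := by
    have h3 : ((ModelWithCorners.pi fun _ : ι => I).symm z ∈
      (OpenPartialHomeomorph.pi fun i => chartAt H (x i)).target) ∧
      z ∈ range (ModelWithCorners.pi fun _ : ι => I) := by
      rw [extChartAt_target] at hz; exact hz
    rw [extChartAt_target]
    refine ⟨h3.1 i (mem_univ _), ?_⟩
    obtain ⟨w, rfl⟩ := h3.2
    exact ⟨w i, rfl⟩
  exact (extChartAt I (x i)).right_inv h2

/-- The differential of a finite sum of compositions with a real function. -/
theorem mfderiv_sum_comp {n : ℕ} {f : M' → ℝ} (hf : MDifferentiable I' 𝓘(ℝ, ℝ) f)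
    {c : Fin n → M → M'} {x : M} {c' : Fin n → E →L[ℝ] E'}
    (hc : ∀ k, HasMFDerivAt I I' (c k) x (c' k)) (v : E) :
    (mfderiv I 𝓘(ℝ, ℝ) (fun y => ∑ k, f (c k y)) x : E →L[ℝ] ℝ) v =
      ∑ k, (mfderiv I' 𝓘(ℝ, ℝ) f (c k x) : E' →L[ℝ] ℝ) (c' k v) := by
  have h1 : HasMFDerivAt I 𝓘(ℝ, ℝ) (∑ k, fun y => f (c k y)) x
      (∑ k, (mfderiv I' 𝓘(ℝ, ℝ) f (c k x) : E' →L[ℝ] ℝ).comp (c' k)) :=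
    HasMFDerivAt.sum fun k _ => (hf (c k x)).hasMFDerivAt.comp x (hc k)
  have h2 : (fun y => ∑ k, f (c k y)) = ∑ k, fun y => f (c k y) := by
    ext y; simp
  have h3 : (mfderiv I 𝓘(ℝ, ℝ) (fun y => ∑ k, f (c k y)) x : E →L[ℝ] ℝ) =
      ∑ k, (mfderiv I' 𝓘(ℝ, ℝ) f (c k x) : E' →L[ℝ] ℝ).comp (c' k) := by
    rw [h2]; exact h1.mfderiv
  have h4 : ∀ T : Fin n → E →L[ℝ] ℝ, (∑ k, T k) v = ∑ k, T k v := fun T => by simp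
  rw [h3]
  exact h4 _

/-- Discrete summation by parts. -/
theorem sum_add_eq_zero_iff {V : Type*} [AddCommGroup V] [Module ℝ V] [TopologicalSpace V] {N : ℕ}
    (a b : Fin N → V →L[ℝ] ℝ) :
    (∀ δ : Fin (N + 1) → V, δ 0 = 0 → δ (Fin.last N) = 0 →
      ∑ k : Fin N, (a k (δ k.castSucc) + b k (δ k.succ)) = 0) ↔
    ∀ (k : ℕ) (_ : 1 ≤ k) (_ : k < N), b ⟨k - 1, by omega⟩ + a ⟨k, by omega⟩ = 0 := by
  cases N with
  | zero => simp
  | succ n =>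
    have key : ∀ δ : Fin (n + 1 + 1) → V, δ 0 = 0 → δ (Fin.last (n + 1)) = 0 →
        ∑ k : Fin (n + 1), (a k (δ k.castSucc) + b k (δ k.succ)) =
        ∑ i : Fin n, (b i.castSucc + a i.succ) (δ i.succ.castSucc) := by
      intro δ h0 h1
      rw [Finset.sum_add_distrib, Fin.sum_univ_succ, Fin.sum_univ_castSucc (n := n)
        (f := fun k => b k (δ k.succ))]
      simp only [Fin.castSucc_zero, h0, Fin.succ_last, h1, map_zero, zero_add, add_zero,
        add_apply, Finset.sum_add_distrib, ← Fin.succ_castSucc]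
      exact add_comm _ _
    constructor
    · intro h k hk hkN
      obtain ⟨m, rfl⟩ := Nat.exists_eq_add_of_le' hk
      let i : Fin n := ⟨m, by omega⟩
      ext v
      have h1 : (0 : Fin (n + 1 + 1)) ≠ i.succ.castSucc := by simp [Fin.ext_iff]
      have h2 : Fin.last (n + 1) ≠ i.succ.castSucc := (Fin.castSucc_lt_last _).ne'
      let δ : Fin (n + 1 + 1) → V := fun j => if j = i.succ.castSucc then v else 0
      have hδ0 : δ 0 = 0 := if_neg h1
      have hδ1 : δ (Fin.last (n + 1)) = 0 := if_neg h2
      have hδi : δ i.succ.castSucc = v := if_pos rfl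
      have hδj : ∀ j : Fin n, j ≠ i → δ j.succ.castSucc = 0 := fun j hj =>
        if_neg (by simpa using hj)
      have h3 := h δ hδ0 hδ1
      rw [key δ hδ0 hδ1, Finset.sum_eq_single i (fun j _ hj => by rw [hδj j hj, map_zero])
        (by simp), hδi] at h3
      exact h3
    · intro h δ h0 h1
      rw [key δ h0 h1]
      refine Finset.sum_eq_zero fun i _ => ?_
      have h2 := h (i + 1) (by omega) (by omega)
      change b i.castSucc + a i.succ = 0 at h2
      rw [h2, zero_apply]

end Calculus

section Smooth

variable {E : Type*} [NormedAddCommGroup E] [NormedSpace ℝ E] [FiniteDimensional ℝ E]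
  {H : Type*} [TopologicalSpace H] {I : ModelWithCorners ℝ E H} [I.Boundaryless]
  {Q : Type*} [TopologicalSpace Q] [ChartedSpace H Q] [IsManifold I ∞ Q]
  {F : Type*} [NormedAddCommGroup F] [NormedSpace ℝ F] [FiniteDimensional ℝ F]
  {H' : Type*} [TopologicalSpace H'] {J : ModelWithCorners ℝ F H'} [J.Boundaryless]
  {G : Type*} [TopologicalSpace G] [ChartedSpace H' G] [Group G] [LieGroup J ∞ G]
  [MulAction G Q] [ContMDiffSMul J I ∞ G Q] [ProperSMul G Q] [IsCancelSMul G Q]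

namespace AffineDiscreteConnection

variable (A : AffineDiscreteConnection I Q J G)

theorem contMDiff_lift :
    ContMDiff (I.prod 𝓘(ℝ, QuotModel E F)) I ∞
      (fun x : Q × OrbitSpace I Q J G => A.lift x.1 x.2) := by
  let D := A.isLocalDiffeomorph.diffeomorphOfBijective ⟨A.injective, A.surjective⟩
  have h1 : ContMDiff (I.prod 𝓘(ℝ, QuotModel E F)) I ∞
      (fun x : Q × OrbitSpace I Q J G => (D.symm x).1.2) :=
    contMDiff_snd.comp (A.isSmoothEmbedding.contMDiff.comp D.symm.contMDiff)
  convert h1 using 2 with x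
  have h2 : ((D.symm x).1.1, orbitProj I J (D.symm x).1.2) = x := D.apply_symm_apply x
  refine (A.lift_eq_iff _ _ _).2 ⟨?_, congrArg Prod.snd h2⟩
  rw [← congrArg Prod.fst h2]
  exact (D.symm x).2

theorem form_smul_lift (q₀ q₁ : Q) :
    A.form (q₀, q₁) • A.lift q₀ (orbitProj I J q₁) = q₁ := by
  have h1 : A.lift q₀ (orbitProj I J q₁) = (A.form (q₀, q₁))⁻¹ • q₁ :=
    (A.lift_eq_iff _ _ _).2 ⟨(A.form_eq_iff q₀ q₁ _).1 rfl, orbitProj_smul I J _ _⟩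
  rw [h1, smul_inv_smul]

theorem form_smul_right (g : G) (q₀ q₁ : Q) : A.form (q₀, g • q₁) = g * A.form (q₀, q₁) := by
  rw [A.form_eq_iff, mul_inv_rev, mul_smul, inv_smul_smul]
  exact (A.form_eq_iff q₀ q₁ _).1 rfl

theorem contMDiff_form : ContMDiff (I.prod I) J ∞ A.form := by
  rintro ⟨a, b⟩
  let g := A.form (a, b)
  let s := (nonempty_localSlice I J (G := G) (A.lift a (orbitProj I J b))).some
  have hy : ContMDiff (I.prod I) I ∞ (fun x : Q × Q => A.lift x.1 (orbitProj I J x.2)) :=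
    A.contMDiff_lift.comp (contMDiff_fst.prodMk ((contMDiff_orbitProj I J).comp contMDiff_snd))
  have hz : ContMDiff (I.prod I) I ∞ (fun x : Q × Q => g⁻¹ • x.2) :=
    (contMDiff_smul (I := J)).comp (contMDiff_const.prodMk contMDiff_snd)
  have hzab : g⁻¹ • b = A.lift a (orbitProj I J b) := by
    rw [inv_smul_eq_iff]; exact (A.form_smul_lift a b).symm
  have hydom : ∀ᶠ x in 𝓝 (a, b), A.lift x.1 (orbitProj I J x.2) ∈ s.dom :=
    hy.continuous.continuousAt.eventually (s.isOpen_dom.mem_nhds s.mem_dom)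
  have hzdom : ∀ᶠ x : Q × Q in 𝓝 (a, b), g⁻¹ • x.2 ∈ s.dom := by
    refine hz.continuous.continuousAt.eventually (s.isOpen_dom.mem_nhds ?_)
    change g⁻¹ • b ∈ s.dom
    rw [hzab]; exact s.mem_dom
  have h1 : ContMDiffAt (I.prod I) J ∞
      (fun x : Q × Q => s.transl (A.lift x.1 (orbitProj I J x.2))) (a, b) :=
    ContMDiffAt.comp (a, b) (s.transl_smooth.contMDiffAt (s.isOpen_dom.mem_nhds s.mem_dom))
      hy.contMDiffAt
  have h2 : ContMDiffAt (I.prod I) J ∞ (fun x : Q × Q => s.transl (g⁻¹ • x.2)) (a, b) :=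
    ContMDiffAt.comp (a, b) (s.transl_smooth.contMDiffAt (s.isOpen_dom.mem_nhds (by
      rw [hzab]; exact s.mem_dom))) hz.contMDiffAt
  have h3 : ContMDiffAt (I.prod I) J ∞ (fun x : Q × Q => g * s.transl (g⁻¹ • x.2) *
      (s.transl (A.lift x.1 (orbitProj I J x.2)))⁻¹) (a, b) :=
    (contMDiffAt_const.mul h2).mul h1.inv
  refine h3.congr_of_eventuallyEq ?_
  filter_upwards [hydom, hzdom] with x hx1 hx2
  set y := A.lift x.1 (orbitProj I J x.2) with hydef
  have hxy : A.form x • y = x.2 := A.form_smul_lift x.1 x.2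
  have hk : (g⁻¹ * A.form x) • y = g⁻¹ • x.2 := by rw [mul_smul, hxy]
  have hp : s.proj (g⁻¹ • x.2) = s.proj y := by
    rw [← hk]; exact s.proj_smul _ y hx1 (by rw [hk]; exact hx2)
  refine IsCancelSMul.right_cancel _ _ y (hxy.trans ?_)
  have e1 := s.transl_smul_sec y hx1
  have e2 := s.transl_smul_sec _ hx2
  rw [mul_smul]
  nth_rewrite 2 [← e1]
  rw [inv_smul_smul, ← hp, mul_smul, e2, smul_inv_smul]

variable (S : DiscreteMechanicalSystem I Q)

theorem contMDiff_liftedLagrangian :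
    ContMDiff (I.prod (J.prod 𝓘(ℝ, QuotModel E F))) 𝓘(ℝ, ℝ) ∞ (A.liftedLagrangian S) := by
  have h1 : ContMDiff (I.prod (J.prod 𝓘(ℝ, QuotModel E F))) I ∞
      (fun x : Q × G × OrbitSpace I Q J G => x.2.1 • A.lift x.1 x.2.2) :=
    (contMDiff_smul (I := J)).comp ((contMDiff_fst.comp contMDiff_snd).prodMk
      (A.contMDiff_lift.comp (contMDiff_fst.prodMk (contMDiff_snd.comp contMDiff_snd))))
  exact S.smooth.comp (contMDiff_fst.prodMk h1)

theorem contMDiff_conjProj : ContMDiff (I.prod J) 𝓘(ℝ, QuotModel (E × F) F) ∞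
    (conjProj I J : Q × G → ConjBundle I J Q G) :=
  contMDiff_orbitProj (I.prod J) J (Q := ConjProd Q J G) (G := G)

theorem contMDiff_reducedLagrangian (hS : S.IsSymmetryGroup G) :
    ContMDiff (𝓘(ℝ, QuotModel (E × F) F).prod 𝓘(ℝ, QuotModel E F)) 𝓘(ℝ, ℝ) ∞
      (A.reducedLagrangian S hS) := by
  rintro ⟨b, τ⟩
  obtain ⟨x, rfl⟩ := orbitProj_surjective (I.prod J) J b
  obtain ⟨σ, hσ, -, hσs⟩ := exists_local_section (I.prod J) J (Q := ConjProd Q J G) (G := G) x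
  have hσ1 : ContMDiffAt 𝓘(ℝ, QuotModel (E × F) F) (I.prod J) ∞
      (σ : ConjBundle I J Q G → Q × G) (orbitProj (I.prod J) J x) := hσ
  have h0 : ContMDiffAt (𝓘(ℝ, QuotModel (E × F) F).prod 𝓘(ℝ, QuotModel E F)) (I.prod J) ∞
      (fun y : ConjBundle I J Q G × OrbitSpace I Q J G => (σ y.1 : Q × G))
      (orbitProj (I.prod J) J x, τ) :=
    ContMDiffAt.comp (orbitProj (I.prod J) J x, τ) hσ1 contMDiffAt_fst
  have h1 : ContMDiffAt (𝓘(ℝ, QuotModel (E × F) F).prod 𝓘(ℝ, QuotModel E F))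
      (I.prod (J.prod 𝓘(ℝ, QuotModel E F))) ∞
      (fun y : ConjBundle I J Q G × OrbitSpace I Q J G =>
        ((σ y.1 : Q × G).1, (σ y.1 : Q × G).2, y.2)) (orbitProj (I.prod J) J x, τ) :=
    (contMDiffAt_fst.comp _ h0).prodMk ((contMDiffAt_snd.comp _ h0).prodMk contMDiffAt_snd)
  refine ((A.contMDiff_liftedLagrangian S).contMDiffAt.comp _ h1).congr_of_eventuallyEq ?_
  filter_upwards [continuousAt_fst.eventually hσs] with y hy
  have h2 := A.reducedLagrangian_conjProj S hS (σ y.1 : Q × G).1 (σ y.1 : Q × G).2 y.2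
  change conjProj I J (σ y.1) = y.1 at hy
  refine Eq.trans ?_ h2
  exact congrArg (A.reducedLagrangian S hS) (Prod.ext hy.symm rfl)

end AffineDiscreteConnection

end Smooth

end DMSReduction
namespace DMSReduction

section Reduction

variable {E : Type*} [NormedAddCommGroup E] [NormedSpace ℝ E] [FiniteDimensional ℝ E]
  {H : Type*} [TopologicalSpace H] {I : ModelWithCorners ℝ E H} [I.Boundaryless]
  {Q : Type*} [TopologicalSpace Q] [ChartedSpace H Q] [IsManifold I ∞ Q]
  {F : Type*} [NormedAddCommGroup F] [NormedSpace ℝ F] [FiniteDimensional ℝ F]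
  {H' : Type*} [TopologicalSpace H'] {J : ModelWithCorners ℝ F H'} [J.Boundaryless]
  {G : Type*} [TopologicalSpace G] [ChartedSpace H' G] [Group G] [LieGroup J ∞ G]
  [MulAction G Q] [ContMDiffSMul J I ∞ G Q] [ProperSMul G Q] [IsCancelSMul G Q]

theorem hasMFDerivAt_orbit (q : Q) :
    HasMFDerivAt J I (fun g : G => g • q) 1 (mfderiv J I (fun g : G => g • q) 1) := by
  have h : ContMDiff J I ∞ (fun g : G => g • q) :=
    (contMDiff_smul (I := J)).comp (contMDiff_id.prodMk contMDiff_const)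
  exact (h.mdifferentiable (by simp) 1).hasMFDerivAt

variable (I J G) in
/-- The infinitesimal generators at `q`, as a linear map on the model spaces. -/
noncomputable def infGenDifferential (q : Q) : F →L[ℝ] E := infGen I J (G := G) q

variable (I J G) in
/-- The differential of the projection onto the orbit space, as a linear map on the model
spaces. -/
noncomputable def projDifferential (q : Q) : E →L[ℝ] QuotModel E F :=
  mfderiv I 𝓘(ℝ, QuotModel E F) (orbitProj I J : Q → OrbitSpace I Q J G) q

theorem hasMFDerivAt_orbitProj (q : Q) : HasMFDerivAt I 𝓘(ℝ, QuotModel E F)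
    (orbitProj I J : Q → OrbitSpace I Q J G) q (projDifferential I J G q) :=
  ((contMDiff_orbitProj I J).mdifferentiable (by simp) q).hasMFDerivAt

theorem projDifferential_infGen (q : Q) (ξ : F) :
    projDifferential I J G q (infGenDifferential I J G q ξ) = 0 :=
  mfderiv_orbitProj_infGen I J q ξ

namespace DiscreteMechanicalSystem

variable (S : DiscreteMechanicalSystem I Q)

theorem mdifferentiable_lagrangian : MDifferentiable (I.prod I) 𝓘(ℝ, ℝ) S.lagrangian :=
  S.smooth.mdifferentiable (by simp)

/-- The differential of the discrete Lagrangian, as a linear map on the model space. -/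
noncomputable def differential (q₀ q₁ : Q) : E × E →L[ℝ] ℝ :=
  mfderiv (I.prod I) 𝓘(ℝ, ℝ) S.lagrangian (q₀, q₁)

theorem differential_infGen_infGen (hS : S.IsSymmetryGroup G) (q₀ q₁ : Q) (ξ : F) :
    S.differential q₀ q₁ (infGenDifferential I J G q₀ ξ,
      infGenDifferential I J G q₁ ξ) = 0 := by
  have h1 := (hasMFDerivAt_orbit (I := I) (J := J) (G := G) q₀).prodMk
    (hasMFDerivAt_orbit (I := I) (J := J) (G := G) q₁)
  have h2 := hasMFDerivAt_comp_of_eq (S.mdifferentiable_lagrangian (q₀, q₁)).hasMFDerivAt h1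
    (by simp)
  have h3 := hasMFDerivAt_unique h2 ((hasMFDerivAt_const (I := J) (I' := 𝓘(ℝ, ℝ))
    (S.lagrangian (q₀, q₁)) (1 : G)).congr_of_eventuallyEq
      (Eventually.of_forall fun g => hS g q₀ q₁))
  exact congrArg (fun f : F →L[ℝ] ℝ => f ξ) h3

theorem mfderiv_action {N : ℕ} (q : Fin (N + 1) → Q) (δ : Fin (N + 1) → E) :
    (mfderiv (ModelWithCorners.pi fun _ : Fin (N + 1) => I) 𝓘(ℝ, ℝ) S.action q :
      (Fin (N + 1) → E) →L[ℝ] ℝ) δ =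
    ∑ k : Fin N, S.differential (q k.castSucc) (q k.succ) (δ k.castSucc, δ k.succ) :=
  mfderiv_sum_comp S.mdifferentiable_lagrangian
    (c := fun k (y : Fin (N + 1) → Q) => (y k.castSucc, y k.succ))
    (fun k => (hasMFDerivAt_eval k.castSucc q).prodMk (hasMFDerivAt_eval k.succ q)) δ

theorem hamiltonPrinciple_iff_eulerLagrange {N : ℕ} (q : Fin (N + 1) → Q) :
    S.HamiltonPrinciple q ↔ S.EulerLagrange q := by
  have hsplit : ∀ (T : E × E →L[ℝ] ℝ) (u v : E), T (u, v) =
      T.comp (ContinuousLinearMap.inl ℝ E E) u + T.comp (ContinuousLinearMap.inr ℝ E E) v :=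
    fun T u v => by simp [← map_add]
  refine Iff.trans (Iff.trans ?_ (sum_add_eq_zero_iff
    (fun k => (S.differential (q k.castSucc) (q k.succ)).comp (ContinuousLinearMap.inl ℝ E E))
    (fun k => (S.differential (q k.castSucc) (q k.succ)).comp (ContinuousLinearMap.inr ℝ E E)))) ?_
  · refine forall_congr' fun δ => forall_congr' fun _ => forall_congr' fun _ => ?_
    refine Eq.congr ((S.mfderiv_action q δ).trans (Finset.sum_congr rfl fun k _ => ?_)) rfl
    exact hsplit _ _ _
  · refine forall_congr' fun k => forall_congr' fun hk => forall_congr' fun hkN => ?_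
    obtain ⟨m, rfl⟩ := Nat.exists_eq_add_of_le' hk
    exact Iff.rfl

end DiscreteMechanicalSystem

namespace AffineDiscreteConnection

variable (A : AffineDiscreteConnection I Q J G)

/-- The differential of the discrete connection form, as a linear map on the model spaces. -/
noncomputable def formDifferential (q₀ q₁ : Q) : E × E →L[ℝ] F := mfderiv (I.prod I) J A.form (q₀, q₁)

theorem hasMFDerivAt_form (q₀ q₁ : Q) :
    HasMFDerivAt (I.prod I) J A.form (q₀, q₁) (A.formDifferential q₀ q₁) :=
  (A.contMDiff_form.mdifferentiable (by simp) (q₀, q₁)).hasMFDerivAt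

theorem formDifferential_infGen_right (q₀ q₁ : Q) (ξ : F) :
    A.formDifferential q₀ q₁ (0, infGenDifferential I J G q₁ ξ) =
      (mfderiv J J (fun x : G => x * A.form (q₀, q₁)) 1 : F →L[ℝ] F) ξ := by
  have h1 := (hasMFDerivAt_const (I := J) (I' := I) q₀ (1 : G)).prodMk
    (hasMFDerivAt_orbit (I := I) (J := J) (G := G) q₁)
  have h2 := hasMFDerivAt_comp_of_eq (A.hasMFDerivAt_form q₀ q₁) h1 (by simp)
  have h3 : ContMDiff J J ∞ (fun x : G => x * A.form (q₀, q₁)) := contMDiff_mul_right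
  have h4 := hasMFDerivAt_unique h2 ((h3.mdifferentiable (by simp) 1).hasMFDerivAt
    |>.congr_of_eventuallyEq (Eventually.of_forall fun g => A.form_smul_right g q₀ q₁))
  exact congrArg (fun f : F →L[ℝ] F => f ξ) h4

variable (S : DiscreteMechanicalSystem I Q)

/-- The differential of the Lagrangian on `Q × G × Q / G` at the image of `(q₀, q₁)`, as a linear
map on the model spaces. -/
noncomputable def liftedDifferential (q₀ q₁ : Q) : E × F × QuotModel E F →L[ℝ] ℝ :=
  mfderiv (I.prod (J.prod 𝓘(ℝ, QuotModel E F))) 𝓘(ℝ, ℝ) (A.liftedLagrangian S)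
    (q₀, A.form (q₀, q₁), orbitProj I J q₁)

theorem differential_eq (q₀ q₁ : Q) (u v : E) :
    S.differential q₀ q₁ (u, v) = A.liftedDifferential S q₀ q₁
      (u, A.formDifferential q₀ q₁ (u, v), projDifferential I J G q₁ v) := by
  have h0 := (A.contMDiff_liftedLagrangian S).mdifferentiable (by simp)
    (q₀, A.form (q₀, q₁), orbitProj I J q₁)
  have h1 : HasMFDerivAt (I.prod I) (I.prod (J.prod 𝓘(ℝ, QuotModel E F)))
      (fun x : Q × Q => (x.1, A.form x, (orbitProj I J x.2 : OrbitSpace I Q J G))) (q₀, q₁)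
      ((ContinuousLinearMap.fst ℝ E E).prod ((A.formDifferential q₀ q₁).prod
        ((projDifferential I J G q₁).comp (ContinuousLinearMap.snd ℝ E E)))) :=
    (hasMFDerivAt_fst (q₀, q₁)).prodMk ((A.hasMFDerivAt_form q₀ q₁).prodMk
      (hasMFDerivAt_comp_of_eq (hasMFDerivAt_orbitProj q₁) (hasMFDerivAt_snd (q₀, q₁)) rfl))
  have h2 := hasMFDerivAt_comp_of_eq h0.hasMFDerivAt h1 rfl
  have h3 := hasMFDerivAt_unique h2
    ((S.mdifferentiable_lagrangian (q₀, q₁)).hasMFDerivAt.congr_of_eventuallyEq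
      (Eventually.of_forall fun x => congrArg S.lagrangian (A.prodEquiv.symm_apply_apply x)))
  exact (congrArg (fun f : E × E →L[ℝ] ℝ => f (u, v)) h3).symm

theorem differential_infGen_right (q₀ q₁ : Q) (ξ : F) :
    S.differential q₀ q₁ (0, infGenDifferential I J G q₁ ξ) =
      rightTranslate (A.form (q₀, q₁)) (diff₂ I J 𝓘(ℝ, QuotModel E F) (A.liftedLagrangian S)
        (q₀, A.form (q₀, q₁), orbitProj I J q₁)) ξ := by
  rw [A.differential_eq S, projDifferential_infGen, A.formDifferential_infGen_right]
  rfl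

theorem hasMFDerivAt_conjProj (x : Q × G) :
    HasMFDerivAt (I.prod J) 𝓘(ℝ, QuotModel (E × F) F)
      (conjProj I J : Q × G → ConjBundle I J Q G) x
      (mfderiv (I.prod J) 𝓘(ℝ, QuotModel (E × F) F)
        (conjProj I J : Q × G → ConjBundle I J Q G) x) :=
  (contMDiff_conjProj.mdifferentiable (by simp) x).hasMFDerivAt

theorem mfderiv_reducedLagrangian (hS : S.IsSymmetryGroup G) (q : Q) (w : G)
    (τ : OrbitSpace I Q J G) (u : E) (v : F) (t : QuotModel E F) :
    (mfderiv (𝓘(ℝ, QuotModel (E × F) F).prod 𝓘(ℝ, QuotModel E F)) 𝓘(ℝ, ℝ)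
      (A.reducedLagrangian S hS) (conjProj I J (q, w), τ) :
        QuotModel (E × F) F × QuotModel E F →L[ℝ] ℝ)
      ((mfderiv (I.prod J) 𝓘(ℝ, QuotModel (E × F) F)
        (conjProj I J : Q × G → ConjBundle I J Q G) (q, w) :
          E × F →L[ℝ] QuotModel (E × F) F) (u, v), t) =
    (mfderiv (I.prod (J.prod 𝓘(ℝ, QuotModel E F))) 𝓘(ℝ, ℝ) (A.liftedLagrangian S)
      (q, w, τ) : E × F × QuotModel E F →L[ℝ] ℝ) (u, v, t) := by
  have h0 := (A.contMDiff_reducedLagrangian S hS).mdifferentiable (by simp)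
    (conjProj I J (q, w), τ)
  let x : Q × G × OrbitSpace I Q J G := (q, w, τ)
  have h1 : HasMFDerivAt (I.prod (J.prod 𝓘(ℝ, QuotModel E F))) (I.prod J)
      (fun x : Q × G × OrbitSpace I Q J G => (x.1, x.2.1)) x
      ((ContinuousLinearMap.fst ℝ E (F × QuotModel E F)).prod
        ((ContinuousLinearMap.fst ℝ F (QuotModel E F)).comp
          (ContinuousLinearMap.snd ℝ E (F × QuotModel E F)))) :=
    (hasMFDerivAt_fst x).prodMk
      (hasMFDerivAt_comp_of_eq (hasMFDerivAt_fst x.2) (hasMFDerivAt_snd x) rfl)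
  have h2 : HasMFDerivAt (I.prod (J.prod 𝓘(ℝ, QuotModel E F))) 𝓘(ℝ, QuotModel E F)
      (fun x : Q × G × OrbitSpace I Q J G => x.2.2) x
      ((ContinuousLinearMap.snd ℝ F (QuotModel E F)).comp
          (ContinuousLinearMap.snd ℝ E (F × QuotModel E F))) :=
    hasMFDerivAt_comp_of_eq (hasMFDerivAt_snd x.2) (hasMFDerivAt_snd x) rfl
  have h3 := hasMFDerivAt_comp_of_eq h0.hasMFDerivAt
    ((hasMFDerivAt_comp_of_eq (hasMFDerivAt_conjProj (q, w)) h1 rfl).prodMk h2) rfl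
  have h4 := hasMFDerivAt_unique h3
    (((A.contMDiff_liftedLagrangian S).mdifferentiable (by simp) x).hasMFDerivAt)
  exact congrArg (fun f : E × F × QuotModel E F →L[ℝ] ℝ => f (u, v, t)) h4

end AffineDiscreteConnection

end Reduction

end DMSReduction
namespace DMSReduction

section Equivalence

variable {E : Type*} [NormedAddCommGroup E] [NormedSpace ℝ E] [FiniteDimensional ℝ E]
  {H : Type*} [TopologicalSpace H] {I : ModelWithCorners ℝ E H} [I.Boundaryless]
  {Q : Type*} [TopologicalSpace Q] [ChartedSpace H Q] [IsManifold I ∞ Q]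
  {F : Type*} [NormedAddCommGroup F] [NormedSpace ℝ F] [FiniteDimensional ℝ F]
  {H' : Type*} [TopologicalSpace H'] {J : ModelWithCorners ℝ F H'} [J.Boundaryless]
  {G : Type*} [TopologicalSpace G] [ChartedSpace H' G] [Group G] [LieGroup J ∞ G]
  [MulAction G Q] [ContMDiffSMul J I ∞ G Q] [ProperSMul G Q] [IsCancelSMul G Q]

namespace PrincipalConnection

variable (𝔄 : PrincipalConnection I Q J G)

/-- The horizontal lift at `q`, as a linear map on the model spaces. -/
noncomputable def horLiftDifferential (q : Q) : QuotModel E F →L[ℝ] E := 𝔄.horLift q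

/-- The connection form at `q`, as a linear map on the model spaces. -/
noncomputable def formModel (q : Q) : E →L[ℝ] F := 𝔄.form q

theorem formModel_infGen (q : Q) (ξ : F) :
    𝔄.formModel q (infGenDifferential I J G q ξ) = ξ :=
  𝔄.form_infGen q ξ

theorem projDifferential_horLift (q : Q) (t : QuotModel E F) :
    projDifferential I J G q (𝔄.horLiftDifferential q t) = t :=
  ((𝔄.horLift_eq_iff q t _).1 rfl).2

theorem horLift_add_infGen (q : Q) (v : E) :
    𝔄.horLiftDifferential q (projDifferential I J G q v) +
      infGenDifferential I J G q (𝔄.formModel q v) = v := by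
  have h1 : 𝔄.formModel q (v - infGenDifferential I J G q (𝔄.formModel q v)) = 0 := by
    rw [map_sub, 𝔄.formModel_infGen, sub_self]
  have h2 : projDifferential I J G q (v - infGenDifferential I J G q (𝔄.formModel q v)) =
      projDifferential I J G q v := by
    rw [map_sub, projDifferential_infGen, sub_zero]
  exact eq_sub_iff_add_eq.1 ((𝔄.horLift_eq_iff q _ _).2 ⟨h1, h2⟩)

end PrincipalConnection

namespace AffineDiscreteConnection

variable (A : AffineDiscreteConnection I Q J G) (S : DiscreteMechanicalSystem I Q)
  (𝔄 : PrincipalConnection I Q J G)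

/-- The differential of the reduced Lagrangian at the image of `(q₀, q₁)`, as a linear map on the
model spaces. -/
noncomputable def reducedDifferential (hS : S.IsSymmetryGroup G) (q₀ q₁ : Q) :
    QuotModel (E × F) F × QuotModel E F →L[ℝ] ℝ :=
  mfderiv (𝓘(ℝ, QuotModel (E × F) F).prod 𝓘(ℝ, QuotModel E F)) 𝓘(ℝ, ℝ)
    (A.reducedLagrangian S hS) (conjProj I J (q₀, A.form (q₀, q₁)), orbitProj I J q₁)

theorem mfderiv_reducedAction (hS : S.IsSymmetryGroup G) {N : ℕ} (q : Fin (N + 1) → Q)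
    (δ : Fin N → QuotModel (E × F) F × QuotModel E F) :
    (mfderiv (ModelWithCorners.pi fun _ : Fin N =>
        𝓘(ℝ, QuotModel (E × F) F).prod 𝓘(ℝ, QuotModel E F)) 𝓘(ℝ, ℝ)
      (A.reducedAction S hS) (A.reducedCurve q) :
        (Fin N → QuotModel (E × F) F × QuotModel E F) →L[ℝ] ℝ) δ =
    ∑ k : Fin N, A.reducedDifferential S hS (q k.castSucc) (q k.succ) (δ k) :=
  mfderiv_sum_comp ((A.contMDiff_reducedLagrangian S hS).mdifferentiable (by simp))
    (c := fun k (y : Fin N → ConjBundle I J Q G × OrbitSpace I Q J G) => y k)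
    (fun k => hasMFDerivAt_eval k (A.reducedCurve q)) δ

/-- The variation of the conjugate bundle component, with values in the model space. -/
noncomputable def reducedVariationModel (q₀ q₁ : Q) (u v : E) : QuotModel (E × F) F :=
  A.reducedVariation q₀ q₁ u v

theorem reducedDifferential_reducedVariation (hS : S.IsSymmetryGroup G) (q₀ q₁ : Q) (u v : E) :
    A.reducedDifferential S hS q₀ q₁
      (A.reducedVariationModel q₀ q₁ u v, projDifferential I J G q₁ v) =
    S.differential q₀ q₁ (u, v) :=
  (A.mfderiv_reducedLagrangian S hS q₀ (A.form (q₀, q₁)) (orbitProj I J q₁) u _ _).trans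
    (A.differential_eq S q₀ q₁ u v).symm

theorem reducedDifferential_variation (hS : S.IsSymmetryGroup G) (q₀ q₁ : Q)
    (t₀ t₁ : QuotModel E F) (ξ₀ ξ₁ : F) :
    A.reducedDifferential S hS q₀ q₁
      (A.reducedVariationModel q₀ q₁ (𝔄.horLiftDifferential q₀ t₀) (𝔄.horLiftDifferential q₁ t₁) +
        A.reducedVariationModel q₀ q₁ (infGenDifferential I J G q₀ ξ₀)
          (infGenDifferential I J G q₁ ξ₁), t₁) =
    S.differential q₀ q₁
      (𝔄.horLiftDifferential q₀ t₀ + infGenDifferential I J G q₀ ξ₀,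
        𝔄.horLiftDifferential q₁ t₁ + infGenDifferential I J G q₁ ξ₁) := by
  have h1 := A.reducedDifferential_reducedVariation S hS q₀ q₁
    (𝔄.horLiftDifferential q₀ t₀) (𝔄.horLiftDifferential q₁ t₁)
  have h2 := A.reducedDifferential_reducedVariation S hS q₀ q₁
    (infGenDifferential I J G q₀ ξ₀) (infGenDifferential I J G q₁ ξ₁)
  rw [𝔄.projDifferential_horLift] at h1
  rw [projDifferential_infGen] at h2
  have h3 := congrArg₂ (· + ·) h1 h2
  simpa only [← map_add, Prod.mk_add_mk, add_zero] using h3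

theorem hamiltonPrinciple_iff_reduced (hS : S.IsSymmetryGroup G) {N : ℕ} (q : Fin (N + 1) → Q) :
    S.HamiltonPrinciple q ↔ A.ReducedVariationalPrinciple S 𝔄 hS q := by
  have key : ∀ (δτ : Fin (N + 1) → QuotModel E F) (ξ : Fin (N + 1) → F),
      (mfderiv (ModelWithCorners.pi fun _ : Fin N =>
          𝓘(ℝ, QuotModel (E × F) F).prod 𝓘(ℝ, QuotModel E F)) 𝓘(ℝ, ℝ)
        (A.reducedAction S hS) (A.reducedCurve q) :
          (Fin N → QuotModel (E × F) F × QuotModel E F) →L[ℝ] ℝ)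
        (fun k => (A.reducedVariationModel (q k.castSucc) (q k.succ)
            (𝔄.horLiftDifferential (q k.castSucc) (δτ k.castSucc))
            (𝔄.horLiftDifferential (q k.succ) (δτ k.succ)) +
          A.reducedVariationModel (q k.castSucc) (q k.succ)
            (infGenDifferential I J G (q k.castSucc) (ξ k.castSucc))
            (infGenDifferential I J G (q k.succ) (ξ k.succ)), δτ k.succ)) =
      (mfderiv (ModelWithCorners.pi fun _ : Fin (N + 1) => I) 𝓘(ℝ, ℝ) S.action q :
        (Fin (N + 1) → E) →L[ℝ] ℝ)
        (fun k => 𝔄.horLiftDifferential (q k) (δτ k) + infGenDifferential I J G (q k) (ξ k)) := by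
    intro δτ ξ
    rw [mfderiv_reducedAction, S.mfderiv_action]
    exact Finset.sum_congr rfl fun k _ => A.reducedDifferential_variation S 𝔄 hS _ _ _ _ _ _
  constructor
  · intro h (δτ : Fin (N + 1) → QuotModel E F) (ξ : Fin (N + 1) → F) δv hδv ht0 htN hξ0 hξN
    have hz : ∀ k, δτ k = 0 → ξ k = 0 →
        𝔄.horLiftDifferential (q k) (δτ k) + infGenDifferential I J G (q k) (ξ k) = 0 :=
      fun k h1 h2 => by rw [h1, h2, map_zero, map_zero, add_zero]
    obtain rfl : δv = _ := funext hδv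
    refine (key δτ ξ).trans (h _ (hz 0 ht0 hξ0) (hz (Fin.last N) htN hξN))
  · intro h (δ : Fin (N + 1) → E) h0 hN
    let δτ : Fin (N + 1) → QuotModel E F := fun k => projDifferential I J G (q k) (δ k)
    let ξ : Fin (N + 1) → F := fun k => 𝔄.formModel (q k) (δ k)
    have hδ : δ = fun k => 𝔄.horLiftDifferential (q k) (δτ k) +
        infGenDifferential I J G (q k) (ξ k) := funext fun k => (𝔄.horLift_add_infGen _ _).symm
    have e0 : δ 0 = 0 := h0
    have eN : δ (Fin.last N) = 0 := hN
    have h1 := h δτ ξ _ (fun k => rfl)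
      (by simp only [δτ, e0]; exact map_zero _) (by simp only [δτ, eN]; exact map_zero _)
      (by simp only [ξ, e0]; exact map_zero _) (by simp only [ξ, eN]; exact map_zero _)
    have h2 := (key δτ ξ).symm.trans h1
    rw [← hδ] at h2
    exact h2

theorem eulerLagrangeCovector_horLift (q₀ q₁ q₂ : Q) (t : QuotModel E F) :
    (S.eulerLagrangeCovector q₀ q₁ q₂ : E →L[ℝ] ℝ) (𝔄.horLiftDifferential q₁ t) =
      (A.horizontalCovector S 𝔄 q₀ q₁ q₂ : QuotModel E F →L[ℝ] ℝ) t := by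
  have h0 : (S.eulerLagrangeCovector q₀ q₁ q₂ : E →L[ℝ] ℝ) (𝔄.horLiftDifferential q₁ t) =
      S.differential q₀ q₁ (0, 𝔄.horLiftDifferential q₁ t) +
        S.differential q₁ q₂ (𝔄.horLiftDifferential q₁ t, 0) := rfl
  have h1 : (A.horizontalCovector S 𝔄 q₀ q₁ q₂ : QuotModel E F →L[ℝ] ℝ) t =
      A.liftedDifferential S q₁ q₂ (𝔄.horLiftDifferential q₁ t, 0, 0) +
      A.liftedDifferential S q₀ q₁ (0, 0, t) +
      A.liftedDifferential S q₁ q₂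
        (0, A.formDifferential q₁ q₂ (𝔄.horLiftDifferential q₁ t, 0), 0) +
      A.liftedDifferential S q₀ q₁
        (0, A.formDifferential q₀ q₁ (0, 𝔄.horLiftDifferential q₁ t), 0) := rfl
  have h2 : ∀ (T : E × F × QuotModel E F →L[ℝ] ℝ) u v w,
      T (u, v, w) = T (u, 0, 0) + T (0, v, 0) + T (0, 0, w) := fun T u v w => by
    simp [← map_add]
  have h3 : ∀ T : E × F × QuotModel E F →L[ℝ] ℝ, T (0, 0, 0) = 0 := fun T => map_zero T
  rw [h0, h1, A.differential_eq S, A.differential_eq S, 𝔄.projDifferential_horLift, map_zero,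
    h2 _ 0 _ t, h2 _ (𝔄.horLiftDifferential q₁ t) _ 0, h3, h3]
  ring

theorem eulerLagrangeCovector_infGen (hS : S.IsSymmetryGroup G) (q₀ q₁ q₂ : Q) (ξ : F) :
    (S.eulerLagrangeCovector q₀ q₁ q₂ : E →L[ℝ] ℝ) (infGenDifferential I J G q₁ ξ) =
      A.verticalCovector S q₀ q₁ q₂ ξ := by
  have h0 : (S.eulerLagrangeCovector q₀ q₁ q₂ : E →L[ℝ] ℝ) (infGenDifferential I J G q₁ ξ) =
      S.differential q₀ q₁ (0, infGenDifferential I J G q₁ ξ) +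
        S.differential q₁ q₂ (infGenDifferential I J G q₁ ξ, 0) := rfl
  have h1 : S.differential q₁ q₂ (infGenDifferential I J G q₁ ξ, 0) +
      S.differential q₁ q₂ (0, infGenDifferential I J G q₂ ξ) = 0 := by
    rw [← map_add, Prod.mk_add_mk, add_zero, zero_add]
    exact S.differential_infGen_infGen hS q₁ q₂ ξ
  rw [h0, eq_neg_of_add_eq_zero_left h1, A.differential_infGen_right, A.differential_infGen_right,
    ← sub_eq_add_neg]
  rfl

theorem eulerLagrange_iff_reducedEquations (hS : S.IsSymmetryGroup G) {N : ℕ}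
    (q : Fin (N + 1) → Q) : S.EulerLagrange q ↔ A.ReducedEquations S 𝔄 q := by
  refine forall_congr' fun k => forall_congr' fun _ => forall_congr' fun _ => ?_
  generalize q ⟨k - 1, _⟩ = q₀, q ⟨k, _⟩ = q₁, q ⟨k + 1, _⟩ = q₂
  let T : E →L[ℝ] ℝ := S.eulerLagrangeCovector q₀ q₁ q₂
  constructor
  · intro h
    have hT : ∀ v, T v = 0 := fun v => congrArg (fun f : E →L[ℝ] ℝ => f v) h
    refine ⟨ContinuousLinearMap.ext fun t => ?_, fun ξ => ?_⟩
    · exact (A.eulerLagrangeCovector_horLift S 𝔄 q₀ q₁ q₂ t).symm.trans (hT _)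
    · exact (A.eulerLagrangeCovector_infGen S hS q₀ q₁ q₂ ξ).symm.trans (hT _)
  · rintro ⟨h1, h2⟩
    refine ContinuousLinearMap.ext fun v => ?_
    change T v = 0
    rw [← 𝔄.horLift_add_infGen q₁ v, map_add]
    have e1 := A.eulerLagrangeCovector_horLift S 𝔄 q₀ q₁ q₂ (projDifferential I J G q₁ v)
    have e2 := A.eulerLagrangeCovector_infGen S hS q₀ q₁ q₂ (𝔄.formModel q₁ v)
    have e3 : (A.horizontalCovector S 𝔄 q₀ q₁ q₂ : QuotModel E F →L[ℝ] ℝ)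
      (projDifferential I J G q₁ v) = 0 :=
      congrArg (fun f : QuotModel E F →L[ℝ] ℝ => f (projDifferential I J G q₁ v)) h1
    exact (congrArg₂ (· + ·) (e1.trans e3) (e2.trans (h2 _))).trans (add_zero 0)

end AffineDiscreteConnection

end Equivalence

end DMSReduction

theorem mainTheorem1
    {E : Type*} [NormedAddCommGroup E] [NormedSpace ℝ E] [FiniteDimensional ℝ E]
    {H : Type*} [TopologicalSpace H] {I : ModelWithCorners ℝ E H} [I.Boundaryless]
    {Q : Type*} [TopologicalSpace Q] [ChartedSpace H Q] [IsManifold I ∞ Q]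
    {F : Type*} [NormedAddCommGroup F] [NormedSpace ℝ F] [FiniteDimensional ℝ F]
    {H' : Type*} [TopologicalSpace H'] {J : ModelWithCorners ℝ F H'} [J.Boundaryless]
    {G : Type*} [TopologicalSpace G] [ChartedSpace H' G] [Group G] [LieGroup J ∞ G]
    [MulAction G Q] [ContMDiffSMul J I ∞ G Q] [ProperSMul G Q] [IsCancelSMul G Q]
    (S : DMSReduction.DiscreteMechanicalSystem I Q) (hS : S.IsSymmetryGroup G)
    (A : DMSReduction.AffineDiscreteConnection I Q J G)
    (𝔄 : DMSReduction.PrincipalConnection I Q J G)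
    {N : ℕ} (q : Fin (N + 1) → Q) :
    List.TFAE [
      S.HamiltonPrinciple q,
      S.EulerLagrange q,
      A.ReducedVariationalPrinciple S 𝔄 hS q,
      A.ReducedEquations S 𝔄 q] := by
  tfae_have 1 ↔ 2 := S.hamiltonPrinciple_iff_eulerLagrange q
  tfae_have 1 ↔ 3 := A.hamiltonPrinciple_iff_reduced S 𝔄 hS q
  tfae_have 2 ↔ 4 := A.eulerLagrange_iff_reducedEquations S 𝔄 hS q
  tfae_finish
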